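/- Let $R$ be a commutative ring with identity and let $\mathrm{Ch}(R)$ be the category of ($\mathbb{Z}$-indexed) complexes of $R$-modules. Let $C$ be a semidualizing $R$-module, that is: $C$ has a projective resolution by finitely generated projective modules, the homothety map $R\to \mathrm{Hom}_R(C,C)$ is an isomorphism, and $\mathrm{Ext}_R^{i}(C,C)=0$ for all $i\ge 1$. Let $\mathcal{P}(R)$ be the class of projective $R$-modules, and let $\mathcal{P}_C(R)$ and $\mathcal{F}_C(R)$ be the classes of modules isomorphic to $C\otimes_R P$ with $P$ projective, respectively to $C\otimes_R F$ with $F$ flat. For a class $\mathcal{X}$ of modules let $\widetilde{\mathcal{X}}$ be the class of exact complexes all of whose cycle modules lie in $\mathcal{X}$. A complex $X$ is called $D_C$-projective if there is an exact sequence of complexes $$\cdots\to P_1\to P_0\xrightarrow{f_0}Q_{-1}\to Q_{-2}\to\cdots$$ with all $P_i\in\widetilde{\mathcal{P}(R)}$ and all $Q_i\in\widetilde{\mathcal{P}_C(R)}$, which remains exact after applying $\mathrm{Hom}_{\mathrm{Ch}(R)}(-,H)$ for every $H\in\widetilde{\mathcal{F}_C(R)}$, such that $X\cong\mathrm{Im}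 f_0$. The $D_C$-projective dimension $D_C\text{-pd}(X)$ of a complex $X$ is the least integer $n\ge 0$ for which there is an exact sequence $0\to G_n\to\cdots\to G_0\to X\to 0$ in $\mathrm{Ch}(R)$ with all $G_i$ $D_C$-projective, and $D_C\text{-pd}(X)=\infty$ if there is no such $n$. Corollary 3.4. Let $0\to X\to Y\to Z\to 0$ be an exact sequence in $\mathrm{Ch}(R)$. Then the following hold. 1. For every integer $n\ge 0$, if $D_C\text{-pd}(Z)\le n$, then $D_C\text{-pd}(X)\le n$ if and only if $D_C\text{-pd}(Y)\le n$. Consequently, $D_C\text{-pd}(X)\le\max\{D_C\text{-pd}(Y),D_C\text{-pd}(Z)\}$ and $D_C\text{-pd}(Y)\le\max\{D_C\text{-pd}(X),D_C\text{-pd}(Z)\}$. 2. If $D_C\text{-pd}(X)>D_C\text{-pd}(Z)$ or $D_C\text{-pd}(Y)>D_C\text{-pd}(Z)$, then $D_C\text{-pd}(X)=D_C\text{-pd}(Y)$. 3. If $D_C\text{-pd}(Z)>0$ and $Y$ is $D_C$-projective, then $D_C\text{-pd}(X)=D_C\text{-pd}(Z)-1$ (where $\infty-1=\infty$). In particular,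 if two of the complexes $X$, $Y$, $Z$ have finite $D_C$-projective dimension, then so does the third. -/

import Mathlib

open CategoryTheory CategoryTheory.Limits

universe u v w

namespace DingC

section Abstract

variable {A : Type w} [Category.{v} A] [Abelian A]

/-- A complex `L` (for instance a sequence indexed by `ℤ`) in an abelian category is
`Hom(-, B)`-exact if `Hom(L, T)` is an exact complex of abelian groups for every `T` in the class
`B`: every `g : L_i ⟶ T` which vanishes on composition with the differential into `L_i` factors
through the differential out of `L_i`. -/
def IsHomExact (L : ChainComplex A ℤ) (B : ObjectProperty A) : Prop :=
  ∀ T : A, B T → ∀ (i : ℤ) (g : L.X i ⟶ T), L.d (i + 1) i ≫ g = 0 →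
    ∃ h : L.X (i - 1) ⟶ T, L.d i (i - 1) ≫ h = g

/-- There is an exact sequence `0 ⟶ G_n ⟶ ⋯ ⟶ G_0 ⟶ X ⟶ 0` with all `G_i` in the class `P`.
It is encoded as an exact complex `L` with `L_0 ≅ X`, `L_{i+1} = G_i` for `0 ≤ i ≤ n`
and `L_{i+1} = 0` for `i > n`. -/
def HasResolutionOfLength (P : ObjectProperty A) (n : ℕ) (X : A) : Prop :=
  ∃ L : ChainComplex A ℕ, L.Acyclic ∧ Nonempty (L.X 0 ≅ X) ∧
    (∀ i : ℕ, i ≤ n → P (L.X (i + 1))) ∧ (∀ i : ℕ, n < i → IsZero (L.X (i + 1)))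

end Abstract

variable {R : Type u} [CommRing R]

/-- `Ch(R)`: the category of `ℤ`-indexed complexes of `R`-modules, with differentials of
degree `-1`. -/
abbrev Ch (R : Type u) [CommRing R] : Type (u + 1) := ChainComplex (ModuleCat.{u} R) ℤ

/-- A semidualizing `R`-module. -/
structure IsSemidualizing (C : ModuleCat.{u} R) : Prop where
  /-- `C` has a projective resolution by finitely generated modules -/
  finite_resolution : ∃ P : ProjectiveResolution C, ∀ n : ℕ, Module.Finite R (P.complex.X n)
  /-- the homothety map `R → Hom_R(C, C)` is an isomorphism -/
  homothety : Function.Bijective (LinearMap.lsmul R C)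
  /-- `Ext^n_R(C, C) = 0` for all `n ≥ 1` -/
  ext_eq_zero : ∀ n : ℕ, 1 ≤ n → Subsingleton (Abelian.Ext.{u} C C n)

/-- The class `𝒫(R)` of projective modules. -/
def projectiveModules (R : Type u) [CommRing R] : ObjectProperty (ModuleCat.{u} R) :=
  fun M => Module.Projective R M

/-- The class `𝒫_C(R)` of `C`-projective modules, i.e. of modules isomorphic to `C ⊗ P`
with `P` projective. -/
def cProjectiveModules (C : ModuleCat.{u} R) : ObjectProperty (ModuleCat.{u} R) :=
  fun M => ∃ P : ModuleCat.{u} R, Module.Projective R P ∧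
    Nonempty (M ≃ₗ[R] TensorProduct R C P)

/-- The class `ℱ_C(R)` of `C`-flat modules, i.e. of modules isomorphic to `C ⊗ F`
with `F` flat. -/
def cFlatModules (C : ModuleCat.{u} R) : ObjectProperty (ModuleCat.{u} R) :=
  fun M => ∃ F : ModuleCat.{u} R, Module.Flat R F ∧
    Nonempty (M ≃ₗ[R] TensorProduct R C F)

/-- For a class `𝒳` of modules, the class of `𝒳`-complexes: the exact complexes all of whose
cycle modules lie in `𝒳`. -/
def tilde (𝒳 : ObjectProperty (ModuleCat.{u} R)) : ObjectProperty (Ch R) :=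
  fun X => X.Acyclic ∧ ∀ i : ℤ, 𝒳 (X.cycles i)

/-- The class of `D_C`-projective complexes. The sequence
`⋯ ⟶ P_1 ⟶ P_0 ⟶ Q_{-1} ⟶ Q_{-2} ⟶ ⋯` of complexes is `L`, with `P_i = L_i` for `i ≥ 0` and
`Q_i = L_i` for `i < 0`. -/
def dcProjective (C : ModuleCat.{u} R) : ObjectProperty (Ch R) :=
  fun X => ∃ L : ChainComplex (Ch R) ℤ,
    L.Acyclic ∧ IsHomExact L (tilde (cFlatModules C)) ∧
    (∀ i : ℤ, 0 ≤ i → tilde (projectiveModules R) (L.X i)) ∧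
    (∀ i : ℤ, i < 0 → tilde (cProjectiveModules C) (L.X i)) ∧
    Nonempty (X ≅ image (L.d 0 (-1)))

/-- The `D_C`-projective dimension of a complex: the least `n` such that the complex has a
resolution of length `n` by `D_C`-projective complexes, and `∞` if there is no such `n`. -/
noncomputable def dcPd (C : ModuleCat.{u} R) (X : Ch R) : ℕ∞ :=
  ⨅ (n : ℕ) (_ : HasResolutionOfLength (dcProjective C) n X), (n : ℕ∞)

end DingC

/-! The dimension estimates hold for every resolving class in an abelian category, that is, one
closed under extensions and kernels of epimorphisms and with enough projectives: the horseshoe lemma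
and Schanuel's pullback argument give `IsResolving.hasDim_iff` and `IsResolving.hasDim_right`. The
substance is that the `D_C`-projective complexes form such a class.

By `dcProjective_eq`, such a complex is recognised from the right half of its resolution: it is
Ext-orthogonal to `tilde (cFlatModules C)` and is coresolved by complexes in `tilde
(cProjectiveModules C)` with all cosyzygies orthogonal as well (`Coresolved`). This condition passes
to extensions and to kernels of epimorphisms. The left half is then built from projective covers,
provided that `tilde (projectiveModules R)` consists of `Coresolved` complexes.

For modules, this last point uses `N ≅ Hom(C, C) ⊗ N`: applying `Hom(-, C) ⊗ N` to a resolution of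
`C` by finitely generated projectives `P_i` gives a coresolution of `N` by the `C`-projectives `C ⊗
P_i^* ⊗ N`. Its cosyzygies are `Hom(K, C) ⊗ N` with `K` a syzygy of `C`, and they are orthogonal to
`C ⊗ F` because the biduality isomorphism `M ⊗ F ≅ Hom(Hom(M, C), C ⊗ F)` is inherited by syzygies
(`isBidual_left`). The result passes to complexes because the complexes involved are sums of disks
(`nonempty_disks_iso`), whose Ext vanishing is checked degreewise (`extVanishing_disks`). -/

namespace DingC

/-! ### Short exact sequences in an abelian category -/

section ShortExact

variable {A : Type w} [Category.{v} A] [Abelian A]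

/-- `0 ⟶ X ⟶ Y ⟶ Z ⟶ 0` is a short exact sequence. -/
def IsSES {X Y Z : A} (i : X ⟶ Y) (p : Y ⟶ Z) : Prop :=
  ∃ w : i ≫ p = 0, (ShortComplex.mk i p w).ShortExact

namespace IsSES

variable {X Y Z : A} {i : X ⟶ Y} {p : Y ⟶ Z}

lemma zero (h : IsSES i p) : i ≫ p = 0 := h.1

lemma mono (h : IsSES i p) : Mono i := h.2.mono_f

lemma epi (h : IsSES i p) : Epi p := h.2.epi_g

lemma lift (h : IsSES i p) {T : A} (x : T ⟶ Y) (hx : x ≫ p = 0) : ∃ y : T ⟶ X, y ≫ i = x := by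
  have := h.mono
  exact ⟨h.2.exact.lift x hx, h.2.exact.lift_f x hx⟩

lemma desc (h : IsSES i p) {T : A} (x : Y ⟶ T) (hx : i ≫ x = 0) : ∃ y : Z ⟶ T, p ≫ y = x := by
  have := h.epi
  exact ⟨h.2.exact.desc x hx, h.2.exact.g_desc x hx⟩

lemma of_refinements (w : i ≫ p = 0) [Mono i] [Epi p]
    (h : ∀ ⦃T : A⦄ (x : T ⟶ Y), x ≫ p = 0 →
      ∃ (T' : A) (π : T' ⟶ T) (_ : Epi π) (y : T' ⟶ X), π ≫ x = y ≫ i) : IsSES i p :=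
  ⟨w, ⟨(ShortComplex.exact_iff_exact_up_to_refinements _).2 h⟩⟩

lemma of_lift (w : i ≫ p = 0) [Mono i] [Epi p]
    (h : ∀ ⦃T : A⦄ (x : T ⟶ Y), x ≫ p = 0 → ∃ y : T ⟶ X, y ≫ i = x) : IsSES i p :=
  of_refinements w fun T x hx => by
    obtain ⟨y, hy⟩ := h x hx
    exact ⟨T, 𝟙 T, inferInstance, y, by rw [Category.id_comp, hy]⟩

lemma of_epi (p : Y ⟶ Z) [Epi p] : IsSES (kernel.ι p) p :=
  of_lift (kernel.condition p) fun _ x hx => ⟨kernel.lift p x hx, kernel.lift_ι p x hx⟩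

lemma op (h : IsSES i p) : IsSES p.op i.op :=
  ⟨by rw [← op_comp, h.zero, op_zero], h.2.op⟩

lemma unop {X Y Z : Aᵒᵖ} {i : X ⟶ Y} {p : Y ⟶ Z} (h : IsSES i p) : IsSES p.unop i.unop :=
  ⟨by rw [← unop_comp, h.zero, unop_zero], h.2.unop⟩

lemma of_mono (i : X ⟶ Y) [Mono i] : IsSES i (cokernel.π i) :=
  ⟨cokernel.condition i, ⟨ShortComplex.exact_cokernel i⟩⟩

lemma iso_left (h : IsSES i p) {X' : A} (e : X' ≅ X) : IsSES (e.hom ≫ i) p := by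
  have := h.mono
  have := h.epi
  refine of_lift (by rw [Category.assoc, h.zero, comp_zero]) fun T x hx => ?_
  obtain ⟨y, hy⟩ := h.lift x hx
  exact ⟨y ≫ e.inv, by simp [hy]⟩

lemma iso_right (h : IsSES i p) {Z' : A} (e : Z ≅ Z') : IsSES i (p ≫ e.hom) := by
  have := h.mono
  have := h.epi
  refine of_lift (by rw [← Category.assoc, h.zero, zero_comp]) fun T x hx => ?_
  exact h.lift x (by simpa [← Category.assoc] using hx)

lemma biprod (X Z : A) : IsSES (biprod.inl : X ⟶ X ⊞ Z) biprod.snd :=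
  of_lift (by simp) fun T x hx => ⟨x ≫ biprod.fst, by ext <;> simp [hx]⟩

lemma id_zero (X : A) {Z : A} (hZ : IsZero Z) : IsSES (𝟙 X) (0 : X ⟶ Z) := by
  have : Epi (0 : X ⟶ Z) := ⟨fun _ _ _ => hZ.eq_of_src _ _⟩
  exact of_lift (by simp) fun T x _ => ⟨x, by simp⟩

lemma zero_id {X : A} (Z : A) (hX : IsZero X) : IsSES (0 : X ⟶ Z) (𝟙 Z) := by
  have : Mono (0 : X ⟶ Z) := ⟨fun _ _ _ => hX.eq_of_tgt _ _⟩
  exact of_lift (by simp) fun T x hx => ⟨0, by simpa using hx.symm⟩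

lemma isIso_right (h : IsSES i p) (hX : IsZero X) : IsIso p := by
  have := h.epi
  obtain ⟨y, hy⟩ := h.desc (𝟙 Y) (hX.eq_of_src _ _)
  exact ⟨y, hy, by rw [← cancel_epi p]; simp [reassoc_of% hy]⟩

/-- The kernels of an epimorphism of short exact sequences form a short exact sequence. -/
lemma kernels {KX KY KZ PX PY PZ : A} {q : Y ⟶ Z}
    {iX : KX ⟶ PX} {pX : PX ⟶ X} {iY : KY ⟶ PY} {pY : PY ⟶ Y} {iZ : KZ ⟶ PZ} {pZ : PZ ⟶ Z}
    {α : PX ⟶ PY} {β : PY ⟶ PZ} (hX : IsSES iX pX) (hY : IsSES iY pY) (hZ : IsSES iZ pZ)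
    (h : IsSES i q) (h' : IsSES α β) (h₁ : α ≫ pY = pX ≫ i) (h₂ : β ≫ pZ = pY ≫ q) :
    ∃ (κ : KX ⟶ KY) (μ : KY ⟶ KZ), IsSES κ μ := by
  obtain ⟨κ, hκ⟩ := hY.lift (iX ≫ α) (by
    rw [Category.assoc, h₁, ← Category.assoc, hX.zero, zero_comp])
  obtain ⟨μ, hμ⟩ := hZ.lift (iY ≫ β) (by
    rw [Category.assoc, h₂, ← Category.assoc, hY.zero, zero_comp])
  have := hX.mono
  have := hY.mono
  have := hZ.mono
  have := h.mono
  have := h'.mono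
  have := h'.epi
  have := hX.epi
  have : Mono κ := by
    have : Mono (κ ≫ iY) := by rw [hκ]; infer_instance
    exact mono_of_mono κ iY
  have : Epi μ := by
    rw [epi_iff_surjective_up_to_refinements]
    intro T z
    obtain ⟨T₁, π₁, hπ₁, y, hy⟩ := surjective_up_to_refinements_of_epi β (z ≫ iZ)
    obtain ⟨x₀, hx₀⟩ := h.lift (y ≫ pY) (by
      rw [Category.assoc, ← h₂, ← Category.assoc, ← hy]; simp [hZ.zero])
    obtain ⟨T₂, π₂, hπ₂, x₁, hx₁⟩ := surjective_up_to_refinements_of_epi pX x₀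
    obtain ⟨t, ht⟩ := hY.lift (π₂ ≫ y - x₁ ≫ α) (by
      rw [Preadditive.sub_comp, Category.assoc, Category.assoc, h₁, ← hx₀, ← reassoc_of% hx₁,
        sub_self])
    refine ⟨T₂, π₂ ≫ π₁, inferInstance, t, ?_⟩
    rw [← cancel_mono iZ, Category.assoc, Category.assoc, hy, Category.assoc, hμ,
      ← Category.assoc t, ht, Preadditive.sub_comp, Category.assoc, Category.assoc, h'.zero]
    simp
  refine ⟨κ, μ, of_lift ?_ fun T y hy => ?_⟩
  · rw [← cancel_mono iZ, Category.assoc, hμ, reassoc_of% hκ, h'.zero]; simp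
  · obtain ⟨x, hx⟩ := h'.lift (y ≫ iY) (by
      rw [Category.assoc, ← hμ, ← Category.assoc, hy, zero_comp])
    obtain ⟨t, ht⟩ := hX.lift x (by
      rw [← cancel_mono i, Category.assoc, ← h₁, ← Category.assoc, hx, Category.assoc, hY.zero]
      simp)
    exact ⟨t, by rw [← cancel_mono iY, Category.assoc, hκ, reassoc_of% ht, hx]⟩

/-- The cokernels of a monomorphism of short exact sequences form a short exact sequence. -/
lemma cokernels {QX QY QZ CX CY CZ : A} {q : Y ⟶ Z}
    {iX : X ⟶ QX} {pX : QX ⟶ CX} {iY : Y ⟶ QY} {pY : QY ⟶ CY} {iZ : Z ⟶ QZ} {pZ : QZ ⟶ CZ}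
    {α : QX ⟶ QY} {β : QY ⟶ QZ} (hX : IsSES iX pX) (hY : IsSES iY pY) (hZ : IsSES iZ pZ)
    (h : IsSES i q) (h' : IsSES α β) (h₁ : i ≫ iY = iX ≫ α) (h₂ : q ≫ iZ = iY ≫ β) :
    ∃ (κ : CX ⟶ CY) (μ : CY ⟶ CZ), IsSES κ μ := by
  obtain ⟨μ, κ, H⟩ := kernels hZ.op hY.op hX.op h.op h'.op
    (by rw [← op_comp, ← op_comp, h₂]) (by rw [← op_comp, ← op_comp, h₁])
  exact ⟨κ.unop, μ.unop, H.unop⟩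

lemma of_isPullback {E W : A} {k : X ⟶ E} {a : E ⟶ Y} {b : E ⟶ W} {q : W ⟶ Z} (h : IsSES i p)
    (sq : IsPullback a b p q) (h₁ : k ≫ a = i) (h₂ : k ≫ b = 0) : IsSES k b := by
  have := h.mono
  have := h.epi
  have : Epi b := Abelian.epi_snd_of_isLimit p q sq.isLimit
  have : Mono k := by
    have : Mono (k ≫ a) := by rw [h₁]; infer_instance
    exact mono_of_mono _ a
  refine of_lift h₂ fun T x hx => ?_
  obtain ⟨y, hy⟩ := h.lift (x ≫ a) (by
    rw [Category.assoc, sq.w, ← Category.assoc, hx, zero_comp])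
  refine ⟨y, sq.hom_ext ?_ ?_⟩
  · rw [Category.assoc, h₁, hy]
  · rw [Category.assoc, h₂, hx, comp_zero]

/-- Schanuel's construction: the pullback of two epimorphisms onto `Z` is an extension of either
source by the kernel of the other map, so two presentations of `Z` can be compared. -/
lemma exists_pullback (h : IsSES i p) {V W : A} {j : V ⟶ W} {q : W ⟶ Z} (h' : IsSES j q) :
    ∃ (E : A) (k : X ⟶ E) (b : E ⟶ W) (l : V ⟶ E) (a : E ⟶ Y), IsSES k b ∧ IsSES l a := by
  have sq := IsPullback.of_hasPullback p q
  refine ⟨_, pullback.lift i 0 (by rw [h.zero, zero_comp]), _,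
    pullback.lift 0 j (by rw [h'.zero, zero_comp]), _,
    h.of_isPullback sq (pullback.lift_fst _ _ _) (pullback.lift_snd _ _ _),
    h'.of_isPullback sq.flip (pullback.lift_snd _ _ _) (pullback.lift_fst _ _ _)⟩

/-- For `X ⊆ Y ⊆ Q` there is a short exact sequence `0 ⟶ Y / X ⟶ Q / X ⟶ Q / Y ⟶ 0`. -/
lemma exists_quotient (h : IsSES i p) {Q B : A} {j : Y ⟶ Q} {q : Q ⟶ B} (h' : IsSES j q) :
    ∃ (E : A) (e : Q ⟶ E) (c : Z ⟶ E) (f : E ⟶ B), IsSES (i ≫ j) e ∧ IsSES c f := by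
  have := h.mono
  have := h'.mono
  have := h.epi
  have := h'.epi
  have H := of_mono (i ≫ j)
  obtain ⟨c, hc⟩ := h.desc (j ≫ cokernel.π (i ≫ j)) (by rw [← Category.assoc, H.zero])
  obtain ⟨f, hf⟩ := H.desc q (by rw [Category.assoc, h'.zero, comp_zero])
  refine ⟨_, _, c, f, H, ?_⟩
  have : Epi f := by
    have : Epi (cokernel.π (i ≫ j) ≫ f) := by rw [hf]; infer_instance
    exact epi_of_epi (cokernel.π (i ≫ j)) f
  have : Mono c := by
    refine Preadditive.mono_of_cancel_zero c fun {T} x hx => ?_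
    obtain ⟨T', π, hπ, y, hy⟩ := surjective_up_to_refinements_of_epi p x
    obtain ⟨z, hz⟩ := H.lift (y ≫ j) (by
      rw [Category.assoc, ← hc, ← reassoc_of% hy, hx, comp_zero])
    rw [← Category.assoc, cancel_mono] at hz
    rw [← cancel_epi π, hy, ← hz, Category.assoc, h.zero, comp_zero, comp_zero]
  refine of_refinements ?_ fun T x hx => ?_
  · rw [← cancel_epi p, reassoc_of% hc, hf, h'.zero, comp_zero]
  · obtain ⟨T', π, hπ, y, hy⟩ := surjective_up_to_refinements_of_epi (cokernel.π (i ≫ j)) x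
    obtain ⟨z, hz⟩ := h'.lift y (by rw [← hf, ← reassoc_of% hy, hx, comp_zero])
    exact ⟨T', π, hπ, z ≫ p, by rw [hy, ← hz, Category.assoc, Category.assoc, hc]⟩

lemma image {f : X ⟶ Y} {g : Y ⟶ Z} {w : f ≫ g = 0} (h : (ShortComplex.mk f g w).Exact) :
    IsSES (Abelian.image.ι f) (Abelian.factorThruImage g) := by
  refine of_refinements ?_ fun T x hx => ?_
  · rw [← cancel_epi (Abelian.factorThruImage _), ← cancel_mono (Abelian.image.ι _)]
    simp [w]
  · obtain ⟨T', q, hq, y, hy⟩ := h.exact_up_to_refinements x (by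
      change x ≫ g = 0
      rw [← Abelian.image.fac g, reassoc_of% hx, zero_comp])
    exact ⟨T', q, hq, y ≫ Abelian.factorThruImage _, by
      rw [Category.assoc, Abelian.image.fac]; exact hy⟩

lemma image_of_epi {f : X ⟶ Y} {g : Y ⟶ Z} [Epi g] {w : f ≫ g = 0}
    (h : (ShortComplex.mk f g w).Exact) : IsSES (Abelian.image.ι f) g := by
  have := (image h).iso_right (asIso (Abelian.image.ι g))
  rwa [asIso_hom, Abelian.image.fac] at this

end IsSES

end ShortExact

/-! ### Ext-orthogonality and coresolved objects -/

section ExtVanishing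

universe t

variable {A : Type w} [Category.{v} A] [Abelian A] [HasExt.{t} A]

/-- `Ext^n(X, T) = 0` for all `n ≥ 1`. -/
def ExtVanishing (X T : A) : Prop := ∀ n : ℕ, Subsingleton (Abelian.Ext.{t} X T (n + 1))

open Abelian.Ext hiding comp_zero zero_comp

namespace ExtVanishing

variable {X Y Z T : A} {i : X ⟶ Y} {p : Y ⟶ Z}

lemma of_projective (P : A) [Projective P] (T : A) : ExtVanishing P T := fun n =>
  subsingleton_of_projective P T n

lemma of_iso (h : ExtVanishing X T) (e : X ≅ Y) : ExtVanishing Y T := fun n =>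
  ⟨fun a b => by
    have key (a : Abelian.Ext Y T (n + 1)) :
        (mk₀ e.inv).comp ((mk₀ e.hom).comp a (zero_add _)) (zero_add _) = a := by
      rw [mk₀_comp_mk₀_assoc, e.inv_hom_id, mk₀_id_comp]
    rw [← key a, ← key b, (h n).elim ((mk₀ e.hom).comp a (zero_add _))
      ((mk₀ e.hom).comp b (zero_add _))]⟩

lemma of_iso_right (h : ExtVanishing X T) {T' : A} (e : T ≅ T') : ExtVanishing X T' := fun n =>
  ⟨fun a b => by
    have key (a : Abelian.Ext X T' (n + 1)) :
        (a.comp (mk₀ e.inv) (add_zero _)).comp (mk₀ e.hom) (add_zero _) = a := by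
      rw [comp_assoc_of_third_deg_zero, mk₀_comp_mk₀, e.inv_hom_id, comp_mk₀_id]
    rw [← key a, ← key b, (h n).elim (a.comp (mk₀ e.inv) (add_zero _))
      (b.comp (mk₀ e.inv) (add_zero _))]⟩

lemma middle (h : IsSES i p) (hX : ExtVanishing X T) (hZ : ExtVanishing Z T) :
    ExtVanishing Y T := fun n => by
  refine subsingleton_of_forall_eq 0 fun a => ?_
  obtain ⟨b, rfl⟩ := contravariant_sequence_exact₂ h.2 T a ((hX n).elim _ _)
  rw [(hZ n).elim b 0, Abelian.Ext.comp_zero]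

lemma middle_right (h : IsSES i p) (hX : ExtVanishing T X) (hZ : ExtVanishing T Z) :
    ExtVanishing T Y := fun n => by
  refine subsingleton_of_forall_eq 0 fun a => ?_
  obtain ⟨b, rfl⟩ := covariant_sequence_exact₂ T h.2 a ((hZ n).elim _ _)
  rw [(hX n).elim b 0, Abelian.Ext.zero_comp]

lemma left (h : IsSES i p) (hY : ExtVanishing Y T) (hZ : ExtVanishing Z T) :
    ExtVanishing X T := fun n => by
  refine subsingleton_of_forall_eq 0 fun a => ?_
  obtain ⟨b, rfl⟩ := contravariant_sequence_exact₁ h.2 T a (add_comm 1 (n + 1))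
    ((hZ (n + 1)).elim _ _)
  rw [(hY n).elim b 0, Abelian.Ext.comp_zero]

lemma extend (h : IsSES i p) (hZ : ExtVanishing Z T) (φ : X ⟶ T) : ∃ ψ : Y ⟶ T, i ≫ ψ = φ := by
  obtain ⟨b, hb⟩ := contravariant_sequence_exact₁ h.2 T (mk₀ φ) (add_comm 1 0) ((hZ 0).elim _ _)
  obtain ⟨ψ, rfl⟩ := (mk₀_bijective Y T).2 b
  refine ⟨ψ, (mk₀_bijective X T).1 ?_⟩
  rw [← hb, mk₀_comp_mk₀]

lemma subsingleton_ext_one (h : IsSES i p) (hY : ExtVanishing Y T)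
    (hl : ∀ φ : X ⟶ T, ∃ ψ : Y ⟶ T, i ≫ ψ = φ) : Subsingleton (Abelian.Ext.{t} Z T 1) := by
  refine subsingleton_of_forall_eq 0 fun a => ?_
  obtain ⟨b, rfl⟩ := contravariant_sequence_exact₃ h.2 T a ((hY 0).elim _ _) (add_comm 1 0)
  obtain ⟨φ, rfl⟩ := (mk₀_bijective X T).2 b
  obtain ⟨ψ, rfl⟩ := hl φ
  rw [← mk₀_comp_mk₀]
  exact h.2.extClass_comp_assoc (mk₀ ψ)

lemma subsingleton_ext_succ (h : IsSES i p) (hY : ExtVanishing Y T) {n : ℕ}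
    (hX : Subsingleton (Abelian.Ext.{t} X T (n + 1))) :
    Subsingleton (Abelian.Ext.{t} Z T (n + 2)) := by
  refine subsingleton_of_forall_eq 0 fun a => ?_
  obtain ⟨b, rfl⟩ := contravariant_sequence_exact₃ h.2 T a ((hY (n + 1)).elim _ _)
    (add_comm 1 (n + 1))
  rw [hX.elim b 0, Abelian.Ext.comp_zero]

lemma right (h : IsSES i p) (hX : ExtVanishing X T) (hY : ExtVanishing Y T)
    (hl : ∀ φ : X ⟶ T, ∃ ψ : Y ⟶ T, i ≫ ψ = φ) : ExtVanishing Z T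
  | 0 => subsingleton_ext_one h hY hl
  | n + 1 => subsingleton_ext_succ h hY (hX n)

/-- A criterion for the vanishing of `Ext` in terms of a class which is closed under some
choice of syzygies. -/
lemma of_syzygies (S : ObjectProperty A)
    (hS : ∀ Z, S Z → ∃ (X Y : A) (i : X ⟶ Y) (p : Y ⟶ Z), IsSES i p ∧ ExtVanishing Y T ∧ S X ∧
      ∀ φ : X ⟶ T, ∃ ψ : Y ⟶ T, i ≫ ψ = φ) {Z : A} (hZ : S Z) : ExtVanishing Z T := fun n => by
  -- Dimension shifting: extending maps from the syzygy kills `Ext^1`, and each higher Ext group of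
  -- `Z` comes from one of its syzygy, which is again in `S`.
  induction n generalizing Z with
  | zero =>
    obtain ⟨X, Y, i, p, h, hY, -, hl⟩ := hS Z hZ
    exact subsingleton_ext_one h hY hl
  | succ n ih =>
    obtain ⟨X, Y, i, p, h, hY, hX, -⟩ := hS Z hZ
    exact subsingleton_ext_succ h hY (ih hX)

end ExtVanishing

/-- The class of objects `X` with `Ext^n(X, T) = 0` for all `n ≥ 1` and all `T` in `H`. -/
def leftPerp (H : ObjectProperty A) : ObjectProperty A := fun X => ∀ T, H T → ExtVanishing X T

/-- The largest class of objects of `leftPerp H` such that every member embeds into an object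
of `Q` with cokernel in the class. -/
def Coresolved (Q H : ObjectProperty A) : ObjectProperty A := fun X =>
  ∃ S : ObjectProperty A, S X ∧ ∀ Y, S Y → leftPerp H Y ∧
    ∃ (E Y' : A) (i : Y ⟶ E) (p : E ⟶ Y'), IsSES i p ∧ Q E ∧ S Y'

namespace Coresolved

variable {Q H : ObjectProperty A} {X Y Z : A} {i : X ⟶ Y} {p : Y ⟶ Z}

lemma leftPerp (h : Coresolved Q H X) : leftPerp H X := by
  obtain ⟨S, hX, hS⟩ := h
  exact (hS X hX).1

lemma exists_cosyzygy (h : Coresolved Q H X) : ∃ (E Y : A) (i : X ⟶ E) (p : E ⟶ Y),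
    IsSES i p ∧ Q E ∧ Coresolved Q H Y := by
  obtain ⟨S, hX, hS⟩ := h
  obtain ⟨-, E, Y, i, p, h₁, h₂, h₃⟩ := hS X hX
  exact ⟨E, Y, i, p, h₁, h₂, S, h₃, hS⟩

/-- The definition is coinductive, so prepending one step only requires adding `X` to the witnessing
class. -/
lemma of_ses (h : IsSES i p) (hX : DingC.leftPerp H X) (hY : Q Y) (hZ : Coresolved Q H Z) :
    Coresolved Q H X := by
  obtain ⟨S, hZ, hS⟩ := hZ
  refine ⟨fun W => W = X ∨ S W, Or.inl rfl, ?_⟩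
  rintro W (rfl | hW)
  · exact ⟨hX, Y, Z, i, p, h, hY, Or.inr hZ⟩
  · obtain ⟨h₁, E, Y', i', p', h₂, h₃, h₄⟩ := hS W hW
    exact ⟨h₁, E, Y', i', p', h₂, h₃, Or.inr h₄⟩

lemma of_iso (h : Coresolved Q H X) (e : X ≅ Y) : Coresolved Q H Y := by
  obtain ⟨E, Z, i, p, h₁, h₂, h₃⟩ := h.exists_cosyzygy
  exact of_ses (h₁.iso_left e.symm) (fun T hT => (h.leftPerp T hT).of_iso e) h₂ h₃

variable (hQH : ∀ E, Q E → H E)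

-- The extensions of coresolved objects are themselves a witnessing class. As `E` lies in `H` and
-- `Z` is orthogonal to `H`, the embedding of `X` into `E` extends to `Y`. Together with `Z ⟶ E'` it
-- embeds `Y` into `E ⊞ E'`, and the cokernel is an extension of the two cosyzygies.
include hQH in
lemma middle (hQ : ∀ E E', Q E → Q E' → Q (E ⊞ E')) (h : IsSES i p) (hX : Coresolved Q H X)
    (hZ : Coresolved Q H Z) : Coresolved Q H Y := by
  refine ⟨fun Y => ∃ (X Z : A) (i : X ⟶ Y) (p : Y ⟶ Z), IsSES i p ∧ Coresolved Q H X ∧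
    Coresolved Q H Z, ⟨X, Z, i, p, h, hX, hZ⟩, ?_⟩
  rintro Y ⟨X, Z, i, p, h, hX, hZ⟩
  refine ⟨fun T hT => (hX.leftPerp T hT).middle h (hZ.leftPerp T hT), ?_⟩
  obtain ⟨E, X', j, q, h₁, h₂, h₃⟩ := hX.exists_cosyzygy
  obtain ⟨E', Z', j', q', h₁', h₂', h₃'⟩ := hZ.exists_cosyzygy
  obtain ⟨l, hl⟩ := (hZ.leftPerp E (hQH E h₂)).extend h j
  have := h₁.mono
  have := h₁'.mono
  have : Mono (biprod.lift l (p ≫ j')) := by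
    refine Preadditive.mono_of_cancel_zero _ fun {T} x hx => ?_
    have hx₁ : x ≫ l = 0 := by simpa using hx =≫ biprod.fst
    have hx₂ : (x ≫ p) ≫ j' = 0 := by simpa using hx =≫ biprod.snd
    obtain ⟨y, rfl⟩ := h.lift x (by rw [← cancel_mono j', hx₂, zero_comp])
    rw [Category.assoc, hl] at hx₁
    rw [zero_of_comp_mono j hx₁, zero_comp]
  have H := IsSES.of_mono (biprod.lift l (p ≫ j'))
  obtain ⟨κ, μ, h₄⟩ := IsSES.cokernels h₁ H h₁' h (IsSES.biprod E E')
    (by ext <;> simp [hl, reassoc_of% h.zero]) (by simp)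
  exact ⟨_, _, _, _, H, hQ E E' h₂ h₂', _, _, κ, μ, h₄, h₃, h₃'⟩

-- Embed `Y` into `E` with coresolved cokernel `Y'`. Then `X` embeds into `E`, and `E / X` is an
-- extension of `Y'` by `Z`, hence coresolved.
include hQH in
lemma left (hQ : ∀ E E', Q E → Q E' → Q (E ⊞ E')) (h : IsSES i p) (hY : Coresolved Q H Y)
    (hZ : Coresolved Q H Z) : Coresolved Q H X := by
  obtain ⟨E, Y', j, q, h₁, h₂, h₃⟩ := hY.exists_cosyzygy
  obtain ⟨F, e, c, f, h₄, h₅⟩ := h.exists_quotient h₁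
  exact of_ses h₄ (fun T hT => (hY.leftPerp T hT).left h (hZ.leftPerp T hT)) h₂
    (hZ.middle hQH hQ h₅ h₃)

end Coresolved

end ExtVanishing

open scoped ZeroObject

/-! ### Splicing short exact sequences, indexed by naturals or by integers -/

section Splice

variable {A : Type w} [Category.{v} A] [Abelian A]
  {α : Type*} [AddRightCancelSemigroup α] [One α] [DecidableEq α]
  {Z L : α → A} {ι : ∀ i, Z (i + 1) ⟶ L i} {π : ∀ i, L i ⟶ Z i}

/-- The complex obtained by splicing short exact sequences `0 ⟶ Z_{i+1} ⟶ L_i ⟶ Z_i ⟶ 0`. -/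
noncomputable abbrev splice (h : ∀ i, IsSES (ι i) (π i)) : ChainComplex A α :=
  ChainComplex.of L (fun n => π (n + 1) ≫ ι n) fun n => by
    rw [Category.assoc, reassoc_of% (h (n + 1)).zero, zero_comp, comp_zero]

variable (h : ∀ i, IsSES (ι i) (π i))

lemma splice_d (n : α) : (splice h).d (n + 1) n = π (n + 1) ≫ ι n :=
  ChainComplex.of_d L (fun n => π (n + 1) ≫ ι n) n

lemma splice_exactAt (n : α) : (splice h).ExactAt (n + 1) := by
  rw [HomologicalComplex.exactAt_iff' _ (n + 1 + 1) (n + 1) n (by simp)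
    (ComplexShape.next_eq' _ rfl), ShortComplex.exact_iff_exact_up_to_refinements]
  intro T x hx
  change T ⟶ L (n + 1) at x
  change x ≫ (splice h).d (n + 1) n = 0 at hx
  have := (h n).mono
  have := (h (n + 1 + 1)).epi
  rw [splice_d, ← Category.assoc] at hx
  obtain ⟨y, hy⟩ := (h (n + 1)).lift x (zero_of_comp_mono _ hx)
  obtain ⟨T', q, hq, z, hz⟩ := surjective_up_to_refinements_of_epi (π (n + 1 + 1)) y
  refine ⟨T', q, hq, z, ?_⟩
  change q ≫ x = z ≫ (splice h).d (n + 1 + 1) (n + 1)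
  rw [splice_d, ← reassoc_of% hz, hy]

end Splice

/-! ### Dimension with respect to a resolving class -/

section Dimension

variable {A : Type w} [Category.{v} A] [Abelian A]

/-- There is an exact sequence `0 ⟶ G_n ⟶ ⋯ ⟶ G_0 ⟶ X ⟶ 0` with all `G_i` in `D`,
expressed recursively in terms of short exact sequences. -/
def HasDim (D : ObjectProperty A) : ℕ → A → Prop
  | 0, X => D X
  | n + 1, X => ∃ (K G : A) (i : K ⟶ G) (p : G ⟶ X), IsSES i p ∧ D G ∧ HasDim D n K

/-- A class of objects closed under extensions and kernels of epimorphisms, which contains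
enough projective objects. -/
structure IsResolving (D : ObjectProperty A) : Prop where
  middle : ∀ {X Y Z : A} {i : X ⟶ Y} {p : Y ⟶ Z}, IsSES i p → D X → D Z → D Y
  left : ∀ {X Y Z : A} {i : X ⟶ Y} {p : Y ⟶ Z}, IsSES i p → D Y → D Z → D X
  exists_projective : ∀ X : A, ∃ (P : A) (p : P ⟶ X), Projective P ∧ D P ∧ Epi p

namespace IsResolving

variable {D : ObjectProperty A} (hD : IsResolving D) {X Y Z : A} {i : X ⟶ Y} {p : Y ⟶ Z}

include hD

lemma zero {X : A} (hX : IsZero X) : D X := by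
  obtain ⟨P, -, -, hP, -⟩ := hD.exists_projective X
  exact hD.left (IsSES.zero_id P hX) hP hP

lemma of_iso (e : X ≅ Y) (h : D X) : D Y :=
  hD.left ((IsSES.id_zero X (isZero_zero A)).iso_left e.symm) h (hD.zero (isZero_zero A))

lemma hasDim_of_iso (e : X ≅ Y) {n : ℕ} (h : HasDim D n X) : HasDim D n Y := by
  cases n with
  | zero => exact hD.of_iso e h
  | succ n =>
    obtain ⟨K, G, i, p, h₁, h₂, h₃⟩ := h
    exact ⟨K, G, i, p ≫ e.hom, h₁.iso_right e, h₂, h₃⟩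

lemma hasDim_of_mem {n : ℕ} (h : D X) : HasDim D n X := by
  induction n generalizing X with
  | zero => exact h
  | succ n ih =>
    exact ⟨0, X, 0, 𝟙 X, IsSES.zero_id X (isZero_zero A), h, ih (hD.zero (isZero_zero A))⟩

lemma hasDim_succ {n : ℕ} (h : HasDim D n X) : HasDim D (n + 1) X := by
  induction n generalizing X with
  | zero => exact hD.hasDim_of_mem h
  | succ n ih =>
    obtain ⟨K, G, i, p, h₁, h₂, h₃⟩ := h
    exact ⟨K, G, i, p, h₁, h₂, ih h₃⟩

lemma hasDim_mono {m n : ℕ} (hmn : m ≤ n) (h : HasDim D m X) : HasDim D n X := by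
  induction n, hmn using Nat.le_induction with
  | base => exact h
  | succ n _ ih => exact hD.hasDim_succ ih

/-- The horseshoe lemma. -/
lemma horseshoe (h : IsSES i p) : ∃ (PX PY PZ KX KY KZ : A) (iX : KX ⟶ PX) (pX : PX ⟶ X)
    (iY : KY ⟶ PY) (pY : PY ⟶ Y) (iZ : KZ ⟶ PZ) (pZ : PZ ⟶ Z) (κ : KX ⟶ KY) (μ : KY ⟶ KZ),
    IsSES iX pX ∧ IsSES iY pY ∧ IsSES iZ pZ ∧ IsSES κ μ ∧ D PX ∧ D PY ∧ D PZ := by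
  obtain ⟨PX, pX, -, hPX, hpX⟩ := hD.exists_projective X
  obtain ⟨PZ, pZ, _, hPZ, hpZ⟩ := hD.exists_projective Z
  have := h.epi
  set l := Projective.factorThru pZ p with hl
  have hlp : l ≫ p = pZ := Projective.factorThru_comp pZ p
  have : Epi (biprod.desc (pX ≫ i) l) := by
    refine Preadditive.epi_of_cancel_zero _ fun {T} x hx => ?_
    have hx₁ : pX ≫ i ≫ x = 0 := by simpa using biprod.inl ≫= hx
    have hx₂ : l ≫ x = 0 := by simpa using biprod.inr ≫= hx
    obtain ⟨y, rfl⟩ := h.desc x (zero_of_epi_comp pX hx₁)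
    rw [reassoc_of% hlp] at hx₂
    rw [zero_of_epi_comp pZ hx₂, comp_zero]
  obtain ⟨κ, μ, H⟩ := IsSES.kernels (IsSES.of_epi pX) (IsSES.of_epi (biprod.desc (pX ≫ i) l))
    (IsSES.of_epi pZ) h (IsSES.biprod PX PZ) (by simp) (by ext <;> simp [h.zero, hlp])
  exact ⟨_, _, _, _, _, _, _, _, _, _, _, _, κ, μ, IsSES.of_epi pX, IsSES.of_epi _,
    IsSES.of_epi pZ, H, hPX, hD.middle (IsSES.biprod PX PZ) hPX hPZ, hPZ⟩

/-- Independence of the chosen presentation of `Z`. The pullback `E` of `Y` and `G` over `Z` is an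
extension of `G` by `X` and of `Y` by `K`, so the dimension bound moves from `K` to `E` to `X`. The
equivalence at level `n` is a hypothesis so that it can be supplied by the induction in
`hasDim_iff`. -/
lemma hasDim_left_of_middle_iff {n : ℕ} (hn : ∀ {X Y Z : A} {i : X ⟶ Y} {p : Y ⟶ Z},
    IsSES i p → HasDim D n Z → (HasDim D n X ↔ HasDim D n Y)) (h : IsSES i p) (hY : D Y)
    (hZ : HasDim D (n + 1) Z) : HasDim D n X := by
  obtain ⟨K, G, j, q, h₁, h₂, h₃⟩ := hZ
  obtain ⟨E, k, b, l, a, hk, hl⟩ := h.exists_pullback h₁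
  exact (hn hk (hD.hasDim_of_mem h₂)).2 ((hn hl (hD.hasDim_of_mem hY)).1 h₃)

/-- Induction on `n`: the horseshoe lemma replaces the sequence by one of first syzygies, and the
comparison of presentations lowers each dimension by one. -/
lemma hasDim_iff (h : IsSES i p) {n : ℕ} (hZ : HasDim D n Z) :
    HasDim D n X ↔ HasDim D n Y := by
  induction n generalizing X Y Z with
  | zero => exact ⟨fun hX => hD.middle h hX hZ, fun hY => hD.left h hY hZ⟩
  | succ n ih =>
    obtain ⟨PX, PY, PZ, KX, KY, KZ, iX, pX, iY, pY, iZ, pZ, κ, μ, hX, hY, hZ', H, h₁, h₂, h₃⟩ :=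
      hD.horseshoe h
    have key := ih H (hD.hasDim_left_of_middle_iff ih hZ' h₃ hZ)
    constructor
    · exact fun h => ⟨_, _, _, _, hY, h₂, key.1 (hD.hasDim_left_of_middle_iff ih hX h₁ h)⟩
    · exact fun h => ⟨_, _, _, _, hX, h₁, key.2 (hD.hasDim_left_of_middle_iff ih hY h₂ h)⟩

lemma hasDim_succ_iff (h : IsSES i p) (hY : D Y) {n : ℕ} :
    HasDim D (n + 1) Z ↔ HasDim D n X :=
  ⟨hD.hasDim_left_of_middle_iff (fun h => hD.hasDim_iff h) h hY, fun hX => ⟨X, Y, i, p, h, hY, hX⟩⟩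

lemma hasDim_right (h : IsSES i p) {n : ℕ} (hX : HasDim D n X) (hY : HasDim D n Y) :
    HasDim D (n + 1) Z := by
  induction n generalizing X Y Z with
  | zero => exact ⟨X, Y, i, p, h, hY, hX⟩
  | succ n ih =>
    obtain ⟨PX, PY, PZ, KX, KY, KZ, iX, pX, iY, pY, iZ, pZ, κ, μ, hX', hY', hZ', H, h₁, h₂, h₃⟩ :=
      hD.horseshoe h
    exact ⟨_, _, _, _, hZ', h₃,
      ih H ((hD.hasDim_succ_iff hX' h₁).1 hX) ((hD.hasDim_succ_iff hY' h₂).1 hY)⟩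

end IsResolving

/-- There are short exact sequences `0 ⟶ Z_{i+1} ⟶ L_i ⟶ Z_i ⟶ 0` with `Z_0 ≅ X`, with `L_i` in `D`
for `i ≤ n` and with `L_i = 0` for `i > n`. -/
def HasSpliceResolution (D : ObjectProperty A) (n : ℕ) (X : A) : Prop :=
  ∃ (Z L : ℕ → A) (ι : ∀ i, Z (i + 1) ⟶ L i) (π : ∀ i, L i ⟶ Z i),
    (∀ i, IsSES (ι i) (π i)) ∧ Nonempty (Z 0 ≅ X) ∧ (∀ i ≤ n, D (L i)) ∧ ∀ i, n < i → IsZero (L i)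

lemma hasDim_of_hasSpliceResolution {D : ObjectProperty A} (hD : IsResolving D) {n : ℕ} {X : A}
    (h : HasSpliceResolution D n X) : HasDim D n X := by
  obtain ⟨Z, L, ι, π, h, ⟨e⟩, hL, hL'⟩ := h
  refine hD.hasDim_of_iso e ?_
  clear e
  induction n generalizing Z L with
  | zero =>
    -- `Z 1` is a quotient of `L 1`, which is zero, so `π 0` is an isomorphism.
    have := (h 1).epi
    have := (h 0).isIso_right (IsZero.of_epi (π 1) (hL' 1 one_pos))
    exact hD.of_iso (asIso (π 0)) (hL 0 le_rfl)
  | succ n ih =>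
    exact ⟨_, _, _, _, h 0, hL 0 (Nat.zero_le _), ih (fun i => Z (i + 1)) (fun i => L (i + 1))
      (ι := fun i => ι (i + 1)) (π := fun i => π (i + 1)) (fun i => h (i + 1))
      (fun i hi => hL _ (by omega)) (fun i hi => hL' _ (by omega))⟩

lemma hasSpliceResolution_of_hasDim {D : ObjectProperty A} {n : ℕ} {X : A}
    (h : HasDim D n X) : HasSpliceResolution D n X := by
  induction n generalizing X with
  | zero =>
    refine ⟨fun i => i.casesOn X fun _ => 0, fun i => i.casesOn X fun _ => 0, fun i => 0,
      fun i => 𝟙 _, ?_, ⟨Iso.refl _⟩, ?_, ?_⟩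
    · exact fun i => IsSES.zero_id _ (isZero_zero A)
    · rintro i hi
      obtain rfl : i = 0 := by omega
      exact h
    · rintro (_ | i) hi
      · omega
      · exact isZero_zero A
  | succ n ih =>
    obtain ⟨K, G, i, p, h₁, h₂, h₃⟩ := h
    obtain ⟨Z, L, ι, π, h, ⟨e⟩, hL, hL'⟩ := ih h₃
    refine ⟨fun i => i.casesOn X Z, fun i => i.casesOn G L,
      fun k => k.casesOn (e.hom ≫ i) ι, fun k => k.casesOn p π, ?_, ⟨Iso.refl _⟩, ?_, ?_⟩
    · rintro (_ | k)
      · exact h₁.iso_left e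
      · exact h k
    · rintro (_ | k) hk
      · exact h₂
      · exact hL k (by omega)
    · rintro (_ | k) hk
      · omega
      · exact hL' k (by omega)

lemma hasSpliceResolution_of_hasResolution {D : ObjectProperty A} {n : ℕ} {X : A}
    (h : HasResolutionOfLength D n X) : HasSpliceResolution D n X := by
  obtain ⟨L, hL, ⟨e⟩, hL₁, hL₂⟩ := h
  have hex (i : ℕ) : (ShortComplex.mk (L.d (i + 2) (i + 1)) (L.d (i + 1) i) (by simp)).Exact :=
    (HomologicalComplex.exactAt_iff' L (i + 2) (i + 1) i (by simp) (by simp)).1 (hL (i + 1))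
  have : Epi (L.d 1 0) := by
    have h := (HomologicalComplex.exactAt_iff' L 1 0 0 (by simp) (by simp)).1 (hL 0)
    exact h.epi_f (L.shape 0 0 (by simp))
  refine ⟨fun i => Abelian.image (L.d (i + 1) i), fun i => L.X (i + 1),
    fun i => Abelian.image.ι _, fun i => Abelian.factorThruImage _, fun i => ?_,
    ⟨asIso (Abelian.image.ι (L.d 1 0)) ≪≫ e⟩, hL₁, hL₂⟩
  exact IsSES.image (hex i)

lemma hasResolution_of_hasSpliceResolution {D : ObjectProperty A} {n : ℕ} {X : A}
    (h : HasSpliceResolution D n X) : HasResolutionOfLength D n X := by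
  obtain ⟨Z, L, ι, π, h, ⟨e⟩, hL, hL'⟩ := h
  -- In `HasResolutionOfLength` the resolved object sits in degree `0`. Hence the sequence `0 ⟶ Z 0
  -- ⟶ Z 0 ⟶ 0 ⟶ 0` is prepended, shifting the indices by one.
  let Z' : ℕ → A := fun i => i.casesOn 0 Z
  let L' : ℕ → A := fun i => i.casesOn (Z 0) L
  let ι' : ∀ i, Z' (i + 1) ⟶ L' i := fun k => k.casesOn (𝟙 (Z 0)) ι
  let π' : ∀ i, L' i ⟶ Z' i := fun k => k.casesOn 0 π
  have h' : ∀ i, IsSES (ι' i) (π' i) := by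
    rintro (_ | k)
    · exact IsSES.id_zero (Z 0) (isZero_zero A)
    · exact h k
  refine ⟨splice h', ?_, ⟨e⟩, hL, fun i hi => hL' i hi⟩
  rintro (_ | k)
  · rw [HomologicalComplex.exactAt_iff' _ (0 + 1) 0 0 (ComplexShape.prev_eq' _ rfl)
      ChainComplex.next_nat_zero]
    refine (ShortComplex.exact_iff_epi _ ((splice h').shape 0 0 (Nat.succ_ne_zero 0))).2 ?_
    change Epi ((splice h').d (0 + 1) 0)
    rw [splice_d]
    exact @epi_comp _ _ _ _ _ (π' (0 + 1)) (h' 1).epi (ι' 0) (inferInstanceAs (Epi (𝟙 (Z 0))))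
  · exact splice_exactAt h' k

lemma hasResolutionOfLength_iff {D : ObjectProperty A} (hD : IsResolving D) (n : ℕ) (X : A) :
    HasResolutionOfLength D n X ↔ HasDim D n X :=
  ⟨fun h => hasDim_of_hasSpliceResolution hD (hasSpliceResolution_of_hasResolution h),
    fun h => hasResolution_of_hasSpliceResolution (hasSpliceResolution_of_hasDim h)⟩

end Dimension

/-! ### Complete resolutions versus coresolutions -/

section CompleteResolution

universe t

variable {A : Type w} [Category.{v} A] [Abelian A]

/-- Putting `i = k + 1` gives the differentials the form `k + 1 ⟶ k` used in splicing and avoids `k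
+ 1 - 1`. -/
lemma isHomExact_iff (L : ChainComplex A ℤ) (B : ObjectProperty A) :
    IsHomExact L B ↔ ∀ T, B T → ∀ (k : ℤ) (g : L.X (k + 1) ⟶ T),
      L.d (k + 1 + 1) (k + 1) ≫ g = 0 → ∃ h : L.X k ⟶ T, L.d (k + 1) k ≫ h = g := by
  constructor
  · intro H T hT k
    have := H T hT (k + 1)
    rwa [add_sub_cancel_right] at this
  · intro H T hT i
    obtain ⟨k, hk⟩ : ∃ k, k = i - 1 := ⟨_, rfl⟩
    rw [← hk]
    obtain rfl : i = k + 1 := by omega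
    exact H T hT k

/-- The images of the differentials of a `Hom(-, H)`-exact complex with components in `P` in
nonnegative degrees and in `Q` in negative degrees. -/
def HasCompleteResolution (P Q H : ObjectProperty A) : ObjectProperty A := fun X =>
  ∃ L : ChainComplex A ℤ, L.Acyclic ∧ IsHomExact L H ∧ (∀ i : ℤ, 0 ≤ i → P (L.X i)) ∧
    (∀ i : ℤ, i < 0 → Q (L.X i)) ∧ Nonempty (X ≅ image (L.d 0 (-1)))

lemma isSES_image_of_acyclic {L : ChainComplex A ℤ} (hL : L.Acyclic) (k : ℤ) :
    IsSES (Abelian.image.ι (L.d (k + 1 + 1) (k + 1)))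
      (Abelian.factorThruImage (L.d (k + 1) k)) :=
  IsSES.image ((HomologicalComplex.exactAt_iff' L (k + 1 + 1) (k + 1) k (by simp) (by simp)).1
    (hL (k + 1)))

variable [HasExt.{t} A] {P Q H : ObjectProperty A}

/-- Each image in `L` has the next image as syzygy, and `Hom(-, T)`-exactness is exactly the
extension property required by `ExtVanishing.of_syzygies`. So all images are orthogonal to `H`, and
the negative part of `L` is the coresolution. -/
lemma coresolved_of_hasCompleteResolution (hPH : ∀ X, P X → leftPerp H X)
    (hQH : ∀ X, Q X → leftPerp H X) {X : A} (hX : HasCompleteResolution P Q H X) :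
    Coresolved Q H X := by
  obtain ⟨L, hL, hL', hP, hQ, ⟨e⟩⟩ := hX
  rw [isHomExact_iff] at hL'
  have hperp (i : ℤ) : leftPerp H (L.X i) := by
    rcases lt_or_ge i 0 with hi | hi
    · exact hQH _ (hQ i hi)
    · exact hPH _ (hP i hi)
  have hZ (k : ℤ) : leftPerp H (Abelian.image (L.d (k + 1) k)) := fun T hT => by
    refine ExtVanishing.of_syzygies (fun Y => ∃ k : ℤ, Y = Abelian.image (L.d (k + 1) k))
      ?_ ⟨k, rfl⟩
    rintro _ ⟨k, rfl⟩
    refine ⟨_, _, _, _, isSES_image_of_acyclic hL k, hperp _ T hT, ⟨k + 1, rfl⟩, fun φ => ?_⟩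
    obtain ⟨ψ, hψ⟩ := hL' T hT (k + 1) (Abelian.factorThruImage _ ≫ φ) (by
      rw [← Abelian.image.fac (L.d (k + 1 + 1 + 1) (k + 1 + 1)), Category.assoc,
        reassoc_of% (isSES_image_of_acyclic hL (k + 1)).zero, zero_comp, comp_zero])
    refine ⟨ψ, ?_⟩
    rw [← cancel_epi (Abelian.factorThruImage _), ← hψ, ← Category.assoc, Abelian.image.fac]
  -- The image of `d_k : L_{k+1} ⟶ L_k` embeds into `L_k`, which lies in `Q` exactly in the range `k
  -- < 0`; `X` itself is the case `k = -1`.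
  refine ⟨fun Y => ∃ k < 0, Nonempty (Y ≅ Abelian.image (L.d (k + 1) k)),
    ⟨-1, by norm_num, ⟨e ≪≫ (Abelian.imageIsoImage _).symm⟩⟩, ?_⟩
  rintro Y ⟨k, hk, ⟨e'⟩⟩
  refine ⟨fun T hT => (hZ k T hT).of_iso e'.symm, ?_⟩
  obtain ⟨l, rfl⟩ : ∃ l, k = l + 1 := ⟨k - 1, by omega⟩
  exact ⟨_, _, _, _, (isSES_image_of_acyclic hL l).iso_left e', hQ _ hk, l, by omega,
    ⟨Iso.refl _⟩⟩

/-- To the left, kernels of covers by objects of `P` stay coresolved; to the right, cosyzygies do.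
Orthogonality of all these objects to `H` makes the spliced complex `Hom(-, H)`-exact. -/
lemma hasCompleteResolution_of_coresolved
    (hP : ∀ X : A, ∃ (E : A) (p : E ⟶ X), P E ∧ Epi p) (hQH : ∀ E, Q E → H E)
    (hQ : ∀ E E', Q E → Q E' → Q (E ⊞ E')) (hPQ : ∀ X, P X → Coresolved Q H X) {X : A}
    (hX : Coresolved Q H X) : HasCompleteResolution P Q H X := by
  -- On the subtype of coresolved objects, a chosen syzygy or cosyzygy is a self-map and can be
  -- iterated.
  have hdown (Y : {Y : A // Coresolved Q H Y}) : ∃ (K : {Y : A // Coresolved Q H Y}) (E : A)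
      (i : K.1 ⟶ E) (p : E ⟶ Y.1), IsSES i p ∧ P E := by
    obtain ⟨E, p, hE, _⟩ := hP Y.1
    exact ⟨⟨kernel p, (hPQ E hE).left hQH hQ (IsSES.of_epi p) Y.2⟩, E, _, p, IsSES.of_epi p, hE⟩
  have hup (Y : {Y : A // Coresolved Q H Y}) : ∃ (K : {Y : A // Coresolved Q H Y}) (E : A)
      (i : Y.1 ⟶ E) (p : E ⟶ K.1), IsSES i p ∧ Q E := by
    obtain ⟨E, K, i, p, h₁, h₂, h₃⟩ := Y.2.exists_cosyzygy
    exact ⟨⟨K, h₃⟩, E, i, p, h₁, h₂⟩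
  choose down hdown using hdown
  choose up hup using hup
  -- `Int.negSucc n` is `-(n + 1)`, whence `n + 1` cosyzygy steps.
  let Z : ℤ → {Y : A // Coresolved Q H Y}
    | Int.ofNat n => down^[n] ⟨X, hX⟩
    | Int.negSucc n => up^[n + 1] ⟨X, hX⟩
  have key (i : ℤ) : ∃ (E : A) (ι : (Z (i + 1)).1 ⟶ E) (π : E ⟶ (Z i).1), IsSES ι π ∧
      (0 ≤ i → P E) ∧ (i < 0 → Q E) := by
    rcases i with n | n
    · obtain ⟨E, ι, π, h₁, h₂⟩ := hdown (Z (Int.ofNat n))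
      have : Z (Int.ofNat n + 1) = down (Z (Int.ofNat n)) := Function.iterate_succ_apply' _ _ _
      rw [this]
      exact ⟨E, ι, π, h₁, fun _ => h₂, fun h => absurd h (by simp)⟩
    · obtain ⟨E, ι, π, h₁, h₂⟩ := hup (Z (Int.negSucc n + 1))
      have : Z (Int.negSucc n) = up (Z (Int.negSucc n + 1)) := by
        rcases n with _ | n
        · rfl
        · exact Function.iterate_succ_apply' _ _ _
      rw [this]
      exact ⟨E, ι, π, h₁, fun h => absurd h (by simp), fun _ => h₂⟩
  choose L ι π h hLP hLQ using key
  refine ⟨splice (Z := fun i => (Z i).1) h, fun i => ?_, ?_, hLP, hLQ, ?_⟩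
  · obtain ⟨n, rfl⟩ : ∃ n, i = n + 1 := ⟨i - 1, by omega⟩
    exact splice_exactAt h n
  · rw [isHomExact_iff]
    intro T hT k g hg
    have := (h (k + 1 + 1)).epi
    rw [splice_d, Category.assoc] at hg
    obtain ⟨φ, rfl⟩ := (h (k + 1)).desc g (zero_of_epi_comp _ hg)
    obtain ⟨ψ, rfl⟩ := ((Z k).2.leftPerp T hT).extend (h k) φ
    exact ⟨ψ, by rw [splice_d, Category.assoc]⟩
  · have hiso (l k : ℤ) (hl : l = k + 1) :
        Nonempty ((Z l).1 ≅ image ((splice (Z := fun i => (Z i).1) h).d l k)) := by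
      subst hl
      have := (h (k + 1)).epi
      have := (h k).mono
      have : StrongEpi (π (k + 1)) := strongEpi_of_epi _
      exact ⟨image.isoStrongEpiMono (π (k + 1)) (ι k)
        (splice_d (Z := fun i => (Z i).1) h k).symm⟩
    exact hiso 0 (-1) (by norm_num)

end CompleteResolution

/-! ### Sums of disks and contractible complexes -/

section Disks

universe t t'

variable {V : Type w} [Category.{v} V] [Abelian V]

lemma IsSES.biprodMap {X Y Z X' Y' Z' : V} {i : X ⟶ Y} {p : Y ⟶ Z} {i' : X' ⟶ Y'} {p' : Y' ⟶ Z'}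
    (h : IsSES i p) (h' : IsSES i' p') : IsSES (biprod.map i i') (biprod.map p p') := by
  have := h.mono
  have := h'.mono
  have := h.epi
  have := h'.epi
  refine IsSES.of_lift ?_ fun T x hx => ?_
  · ext <;> simp [h.zero, h'.zero]
  · obtain ⟨y, hy⟩ := h.lift (x ≫ biprod.fst) (by simpa using hx =≫ biprod.fst)
    obtain ⟨y', hy'⟩ := h'.lift (x ≫ biprod.snd) (by simpa using hx =≫ biprod.snd)
    exact ⟨biprod.lift y y', by ext <;> simp [hy, hy']⟩

lemma IsSES.isIso_desc {X Y Z : V} {i : X ⟶ Y} {p : Y ⟶ Z} (h : IsSES i p) {s : Z ⟶ Y}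
    (hs : s ≫ p = 𝟙 Z) : IsIso (biprod.desc s i) := by
  have := h.mono
  have := h.epi
  have : Mono (biprod.desc s i) := by
    refine Preadditive.mono_of_cancel_zero _ fun {T} x hx => ?_
    have hx₁ : x ≫ biprod.fst = 0 := by
      have := hx =≫ p
      rwa [Category.assoc, show biprod.desc s i ≫ p = biprod.fst by ext <;> simp [hs, h.zero],
        zero_comp] at this
    have hx₂ : x ≫ biprod.snd = 0 := by
      rw [← cancel_mono i, zero_comp, ← hx, biprod.desc_eq, Preadditive.comp_add,
        reassoc_of% hx₁, zero_comp, zero_add, Category.assoc]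
    ext <;> simp [hx₁, hx₂]
  have : Epi (biprod.desc s i) := by
    refine Preadditive.epi_of_cancel_zero _ fun {T} x hx => ?_
    have hx₁ : s ≫ x = 0 := by simpa using biprod.inl ≫= hx
    obtain ⟨y, rfl⟩ := h.desc x (by simpa using biprod.inr ≫= hx)
    rw [reassoc_of% hs] at hx₁
    rw [hx₁, comp_zero]
  exact isIso_of_mono_of_epi _

lemma isSES_complex_iff {X Y Z : ChainComplex V ℤ} (i : X ⟶ Y) (p : Y ⟶ Z) :
    IsSES i p ↔ ∀ n, IsSES (i.f n) (p.f n) := by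
  constructor
  · rintro ⟨w, h⟩ n
    exact ⟨_, h.map_of_exact (HomologicalComplex.eval V (ComplexShape.down ℤ) n)⟩
  · intro h
    exact ⟨by ext n; exact (h n).zero,
      HomologicalComplex.shortExact_of_degreewise_shortExact _ fun n => (h n).2⟩

/-- The direct sum of the disks `⋯ ⟶ 0 ⟶ N_n ⟶ N_n ⟶ 0 ⟶ ⋯`, where the left copy of `N_n` is in
degree `n`. -/
noncomputable abbrev disks (N : ℤ → V) : ChainComplex V ℤ :=
  ChainComplex.of (fun n => N n ⊞ N (n + 1)) (fun _ => biprod.fst ≫ biprod.inr)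
    fun _ => by simp

lemma disks_d (N : ℤ → V) (n : ℤ) : (disks N).d (n + 1) n = biprod.fst ≫ biprod.inr :=
  ChainComplex.of_d (fun n => N n ⊞ N (n + 1)) (fun _ => biprod.fst ≫ biprod.inr) n

/-- Maps out of `disks N` are given by families of maps out of the `N_n`. -/
noncomputable def disksDesc {N : ℤ → V} {K : ChainComplex V ℤ} (f : ∀ n, N n ⟶ K.X n) :
    disks N ⟶ K where
  f n := biprod.desc (f n) (f (n + 1) ≫ K.d (n + 1) n)
  comm' i j hij := by
    obtain rfl : j + 1 = i := hij
    rw [disks_d]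
    ext <;> simp

lemma disksDesc_f {N : ℤ → V} {K : ChainComplex V ℤ} (f : ∀ n, N n ⟶ K.X n) (n : ℤ) :
    (disksDesc f).f n = biprod.desc (f n) (f (n + 1) ≫ K.d (n + 1) n) := rfl

lemma disks_hom_ext {N : ℤ → V} {K : ChainComplex V ℤ} {f g : disks N ⟶ K}
    (h : ∀ n, biprod.inl ≫ f.f n = biprod.inl ≫ g.f n) : f = g := by
  ext n : 1
  have key (f : disks N ⟶ K) : biprod.inr ≫ f.f n = (biprod.inl ≫ f.f (n + 1)) ≫ K.d (n + 1) n := by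
    rw [Category.assoc, f.comm, disks_d]
    simp
  apply biprod.hom_ext'
  · exact h n
  · rw [key, key, h]

/-- The functoriality of `disks N` in `N`. -/
noncomputable def disksMap {N N' : ℤ → V} (f : ∀ n, N n ⟶ N' n) : disks N ⟶ disks N' where
  f n := biprod.map (f n) (f (n + 1))
  comm' i j hij := by
    obtain rfl : j + 1 = i := hij
    rw [disks_d, disks_d]
    ext <;> simp

lemma isSES_disksMap {X Y Z : ℤ → V} {i : ∀ n, X n ⟶ Y n} {p : ∀ n, Y n ⟶ Z n}
    (h : ∀ n, IsSES (i n) (p n)) : IsSES (disksMap i) (disksMap p) :=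
  (isSES_complex_iff _ _).2 fun n => (h n).biprodMap (h (n + 1))

lemma projective_disks {N : ℤ → V} (hN : ∀ n, Projective (N n)) : Projective (disks N) where
  factors {E X} f e _ := by
    have (n : ℤ) : Epi (e.f n) := inferInstance
    refine ⟨disksDesc fun n => Projective.factorThru (biprod.inl ≫ f.f n) (e.f n),
      disks_hom_ext fun n => ?_⟩
    rw [HomologicalComplex.comp_f, disksDesc_f, biprod.inl_desc_assoc, Projective.factorThru_comp]

/-- A map out of `disks N` is just a family of maps out of the `N n`. Projective covers of the `N n`
give a projective disk complex whose kernel is again of this form, and maps extend degree by degree.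
-/
lemma extVanishing_disks [HasExt.{t} V] [EnoughProjectives V] [HasExt.{t'} (ChainComplex V ℤ)]
    {N : ℤ → V} {K : ChainComplex V ℤ} (h : ∀ n, ExtVanishing (N n) (K.X n)) :
    ExtVanishing (disks N) K := by
  refine ExtVanishing.of_syzygies
    (fun E => ∃ N : ℤ → V, E = disks N ∧ ∀ n, ExtVanishing (N n) (K.X n)) ?_ ⟨N, rfl, h⟩
  rintro _ ⟨N, rfl, h⟩
  have hs (n : ℤ) := IsSES.of_epi (Projective.π (N n))
  have := projective_disks (N := fun n => Projective.over (N n)) fun n => inferInstance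
  refine ⟨_, _, _, _, isSES_disksMap hs, ExtVanishing.of_projective _ _,
    ⟨_, rfl, fun n => (ExtVanishing.of_projective _ _).left (hs n) (h n)⟩, fun φ => ?_⟩
  choose ψ hψ using fun n => (h n).extend (hs n) (biprod.inl ≫ φ.f n)
  refine ⟨disksDesc ψ, disks_hom_ext fun n => ?_⟩
  rw [← hψ, HomologicalComplex.comp_f, disksDesc_f]
  simp [disksMap]

lemma disks_acyclic (N : ℤ → V) : (disks N).Acyclic := fun i => by
  obtain ⟨n, rfl⟩ : ∃ n, i = n + 1 := ⟨i - 1, by omega⟩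
  rw [HomologicalComplex.exactAt_iff' _ (n + 1 + 1) (n + 1) n (by simp) (by simp),
    ShortComplex.exact_iff_exact_up_to_refinements]
  intro T x hx
  change T ⟶ N (n + 1) ⊞ N (n + 1 + 1) at x
  change x ≫ (disks N).d (n + 1) n = 0 at hx
  rw [disks_d] at hx
  refine ⟨T, 𝟙 T, inferInstance, biprod.lift (x ≫ biprod.snd) 0, ?_⟩
  change 𝟙 T ≫ x = biprod.lift (x ≫ biprod.snd) 0 ≫ (disks N).d (n + 1 + 1) (n + 1)
  rw [disks_d]
  have : x ≫ biprod.fst = 0 := by simpa using hx =≫ biprod.snd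
  ext <;> simp [this]

/-- The cycles of `disks N`. -/
noncomputable def disksCyclesIso (N : ℤ → V) (n : ℤ) : (disks N).cycles n ≅ N (n + 1) where
  hom := (disks N).iCycles n ≫ biprod.snd
  inv := (disks N).liftCycles (biprod.inr : N (n + 1) ⟶ N n ⊞ N (n + 1)) (n - 1) (by simp) (by
    obtain ⟨k, rfl⟩ : ∃ k, n = k + 1 := ⟨n - 1, by omega⟩
    obtain ⟨l, hl⟩ : ∃ l, l = k + 1 - 1 := ⟨_, rfl⟩
    rw [← hl]
    obtain rfl : l = k := by omega
    rw [disks_d]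
    simp)
  hom_inv_id := by
    rw [← cancel_mono ((disks N).iCycles n), Category.assoc, HomologicalComplex.liftCycles_i,
      Category.id_comp, Category.assoc]
    have : (disks N).iCycles n ≫ biprod.fst = 0 := by
      obtain ⟨k, rfl⟩ : ∃ k, n = k + 1 := ⟨n - 1, by omega⟩
      have := (disks N).iCycles_d (k + 1) k =≫ (biprod.snd : N k ⊞ N (k + 1) ⟶ _)
      rw [disks_d] at this
      simpa using this
    ext <;> simp [this]
  inv_hom_id := by
    rw [HomologicalComplex.liftCycles_i_assoc, biprod.inr_snd]

variable {K : ChainComplex V ℤ}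

lemma isSES_opcycles (hK : K.Acyclic) (n : ℤ) :
    IsSES (K.fromOpcycles (n + 1) n) (K.pOpcycles n) := by
  have hex := (HomologicalComplex.exactAt_iff' K (n + 1 + 1) (n + 1) n (by simp) (by simp)).1
    (hK (n + 1))
  have : Mono (K.fromOpcycles (n + 1) n) := by
    refine Preadditive.mono_of_cancel_zero _ fun {T} x hx => ?_
    obtain ⟨T₁, π₁, _, y, hy⟩ := surjective_up_to_refinements_of_epi (K.pOpcycles (n + 1)) x
    obtain ⟨T₂, π₂, _, z, hz⟩ := hex.exact_up_to_refinements y (by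
      change y ≫ K.d (n + 1) n = 0
      rw [← K.p_fromOpcycles, ← reassoc_of% hy, hx, comp_zero])
    change T₂ ⟶ K.X (n + 1 + 1) at z
    change π₂ ≫ y = z ≫ K.d (n + 1 + 1) (n + 1) at hz
    rw [← cancel_epi (π₂ ≫ π₁), Category.assoc, hy, reassoc_of% hz, K.d_pOpcycles, comp_zero,
      comp_zero]
  have hex' := (ShortComplex.mk _ _ (K.d_pOpcycles (n + 1) n)).exact_of_g_is_cokernel
    (K.opcyclesIsCokernel (n + 1) n (by simp))
  refine IsSES.of_refinements ?_ fun T x hx => ?_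
  · rw [← cancel_epi (K.pOpcycles (n + 1)), K.p_fromOpcycles_assoc, K.d_pOpcycles, comp_zero]
  · obtain ⟨T₁, π₁, hπ₁, y, hy⟩ := hex'.exact_up_to_refinements x hx
    exact ⟨T₁, π₁, hπ₁, y ≫ K.pOpcycles (n + 1), by
      rw [Category.assoc, K.p_fromOpcycles]; exact hy⟩

/-- Both objects are the kernel of `K.pOpcycles n`: one by `isSES_opcycles`, the other because
`fromOpcycles` is mono in an acyclic complex. -/
lemma nonempty_opcycles_iso_cycles (hK : K.Acyclic) (n : ℤ) :
    Nonempty (K.opcycles (n + 1) ≅ K.cycles n) := by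
  have h := isSES_opcycles hK n
  have := h.mono
  obtain ⟨φ, hφ⟩ := h.lift (K.iCycles n) (by
    obtain ⟨m, rfl⟩ : ∃ m, n = m + 1 := ⟨n - 1, by omega⟩
    have := (isSES_opcycles hK m).mono
    rw [← cancel_mono (K.fromOpcycles (m + 1) m), Category.assoc, K.p_fromOpcycles,
      K.iCycles_d, zero_comp])
  refine ⟨⟨K.opcyclesToCycles (n + 1) n, φ, ?_, ?_⟩⟩
  · rw [← cancel_mono (K.fromOpcycles (n + 1) n), Category.assoc, hφ,
      K.opcyclesToCycles_iCycles, Category.id_comp]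
  · rw [← cancel_mono (K.iCycles n), Category.assoc, K.opcyclesToCycles_iCycles, hφ,
      Category.id_comp]

/-- Vanishing of `Ext^1` splits each sequence `0 ⟶ opcycles (n + 1) ⟶ K_n ⟶ opcycles n ⟶ 0`, and the
sections assemble to an isomorphism from the disks. -/
lemma nonempty_disks_iso [HasExt.{t} V] (hK : K.Acyclic)
    (h : ∀ n, ExtVanishing (K.opcycles n) (K.opcycles (n + 1))) :
    Nonempty (disks (fun n => K.opcycles n) ≅ K) := by
  have hs (n : ℤ) : ∃ s : K.opcycles n ⟶ K.X n, s ≫ K.pOpcycles n = 𝟙 _ := by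
    have H := isSES_opcycles hK n
    obtain ⟨r, hr⟩ := (h n).extend H (𝟙 _)
    obtain ⟨s, hs⟩ := H.desc (𝟙 _ - r ≫ K.fromOpcycles (n + 1) n) (by
      rw [Preadditive.comp_sub, reassoc_of% hr, Category.comp_id, sub_self])
    refine ⟨s, ?_⟩
    rw [← cancel_epi (K.pOpcycles n), reassoc_of% hs, Preadditive.sub_comp, Category.assoc, H.zero]
    simp
  choose s hs using hs
  have (n : ℤ) : IsIso ((disksDesc s).f n) := by
    rw [disksDesc_f, ← K.p_fromOpcycles, reassoc_of% (hs (n + 1))]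
    exact (isSES_opcycles hK n).isIso_desc (hs n)
  have := HomologicalComplex.Hom.isIso_of_components (disksDesc s)
  exact ⟨asIso (disksDesc s)⟩

end Disks

/-! ### Tensor evaluation and biduality maps -/

section LinearAlgebra

open TensorProduct LinearMap

variable {R : Type u} [CommRing R] {C F K P M N Z : Type*} [AddCommGroup C] [Module R C]
  [AddCommGroup F] [Module R F] [AddCommGroup K] [Module R K] [AddCommGroup P] [Module R P]
  [AddCommGroup M] [Module R M] [AddCommGroup N] [Module R N] [AddCommGroup Z] [Module R Z]

/-- Precomposition with `f`. -/
abbrev precomp (C : Type*) [AddCommGroup C] [Module R C] (f : M →ₗ[R] N) :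
    (N →ₗ[R] C) →ₗ[R] (M →ₗ[R] C) := lcomp R C f

variable (R C F N) in
/-- The natural map `Hom(N, C) ⊗ F → Hom(N, C ⊗ F)`. -/
abbrev homTensor : (N →ₗ[R] C) ⊗[R] F →ₗ[R] (N →ₗ[R] C ⊗[R] F) :=
  rTensorHomToHomRTensor (.id R) N C F

lemma homTensor_precomp (f : M →ₗ[R] N) (x : (N →ₗ[R] C) ⊗[R] F) :
    homTensor R C F M ((precomp C f).rTensor F x) = homTensor R C F N x ∘ₗ f := by
  induction x with
  | zero => simp
  | add x y hx hy => simp only [map_add, hx, hy, add_comp]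
  | tmul α y => ext m; simp

lemma homTensor_bijective_of_projective [Module.Finite R P] [Module.Projective R P] :
    Function.Bijective (homTensor R C F P) := by
  rw [homTensor, ← rTensorHomEquivHomRTensor_toLinearMap]
  exact (rTensorHomEquivHomRTensor R P C F).bijective

variable {i : K →ₗ[R] P} {p : P →ₗ[R] M}

lemma homTensor_injective [Module.Flat R F] [Module.Finite R P] [Module.Projective R P]
    (hp : Function.Surjective p) : Function.Injective (homTensor R C F M) := by
  rw [injective_iff_map_eq_zero]
  intro x hx
  refine (injective_iff_map_eq_zero _).1 (Module.Flat.rTensor_preserves_injective_linearMap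
    (precomp C p) (lcomp_injective_of_surjective p hp)) x ?_
  refine (injective_iff_map_eq_zero _).1 (homTensor_bijective_of_projective (R := R)).1 _ ?_
  rw [homTensor_precomp, hx, LinearMap.zero_comp]

/-- A diagram chase: `Hom(-, C) ⊗ F` and `Hom(-, C ⊗ F)` are both left exact as `F` is flat, the map
is bijective at `P`, and injectivity at `K` suffices. -/
lemma homTensor_bijective [Module.Flat R F] [Module.Finite R P] [Module.Projective R P]
    (hp : Function.Surjective p) (hip : Function.Exact i p)
    (hK : Function.Injective (homTensor R C F K)) : Function.Bijective (homTensor R C F M) := by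
  refine ⟨homTensor_injective hp, fun φ => ?_⟩
  obtain ⟨y, hy⟩ := (homTensor_bijective_of_projective (R := R)).2 (φ ∘ₗ p)
  have h₀ : (precomp C i).rTensor F y = 0 := by
    apply hK
    rw [homTensor_precomp, hy, comp_assoc, hip.linearMap_comp_eq_zero, LinearMap.comp_zero, map_zero]
  obtain ⟨x, rfl⟩ := (Module.Flat.rTensor_exact F
    (exact_lcomp_of_exact_of_surjective C hip hp) y).1 h₀
  rw [homTensor_precomp] at hy
  exact ⟨x, (LinearMap.cancel_right hp).1 hy⟩

variable (R C F M) in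
/-- The natural map `M ⊗ F → Hom(Hom(M, C), C ⊗ F)`. -/
noncomputable abbrev biduality : M ⊗[R] F →ₗ[R] ((M →ₗ[R] C) →ₗ[R] C ⊗[R] F) :=
  (rTensorHom F).flip

lemma biduality_apply (y : M ⊗[R] F) (α : M →ₗ[R] C) :
    biduality R C F M y α = α.rTensor F y := rfl

lemma biduality_rTensor (f : M →ₗ[R] N) (y : M ⊗[R] F) (α : N →ₗ[R] C) :
    biduality R C F N (f.rTensor F y) α = biduality R C F M y (α ∘ₗ f) := by
  rw [biduality_apply, biduality_apply, rTensor_comp_apply]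

/-- Since `Hom(C, C)` is generated by the identity, evaluation at the identity is inverse to the
biduality map. -/
lemma biduality_self_bijective (hC : Function.Bijective (LinearMap.lsmul R C)) :
    Function.Bijective (biduality R C F C) := by
  refine ⟨(injective_iff_map_eq_zero _).2 fun y hy => ?_, fun φ => ⟨φ LinearMap.id, ?_⟩⟩
  · have := congr($hy LinearMap.id)
    rwa [biduality_apply, rTensor_id, LinearMap.id_apply, LinearMap.zero_apply] at this
  · ext α : 1
    obtain ⟨r, rfl⟩ := hC.2 α
    have h : lsmul R C r = r • LinearMap.id := by ext; simp
    rw [h, map_smul, map_smul, biduality_apply, rTensor_id, LinearMap.id_apply]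

/-- The map factors as `F ≅ R ⊗ F ≅ Hom(C, C) ⊗ F ≅ Hom(C, C ⊗ F)`. -/
lemma mk_bijective (hC : Function.Bijective (LinearMap.lsmul R C))
    (hC' : Function.Bijective (homTensor R C F C)) :
    Function.Bijective ((TensorProduct.mk R C F).flip) := by
  have h₁ : Function.Bijective ((LinearMap.lsmul R C).rTensor F) :=
    ((LinearEquiv.ofBijective _ hC).rTensor F).bijective
  have h₂ := hC'.comp (h₁.comp (TensorProduct.lid R F).symm.bijective)
  convert h₂ using 1
  ext y c
  simp

lemma rTensor_smulRight (ξ : P →ₗ[R] R) (c : C) (y : P ⊗[R] F) :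
    (ξ.smulRight c).rTensor F y = c ⊗ₜ TensorProduct.lid R F (ξ.rTensor F y) := by
  induction y with
  | zero => simp
  | add x y hx hy => simp only [map_add, hx, hy, tmul_add]
  | tmul p y => simp [smul_tmul]

/-- A finite dual basis `ξ`, `e` of `P` reduces the claim to `P = R`, where the map is `F → Hom(C, C
⊗ F)`. -/
lemma biduality_bijective_of_projective [Module.Finite R P] [Module.Projective R P]
    (hC : Function.Bijective ((TensorProduct.mk R C F).flip)) :
    Function.Bijective (biduality R C F P) := by
  obtain ⟨n, f, g, -, -, hfg⟩ := Module.Finite.exists_comp_eq_id_of_projective R P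
  let ξ (j : Fin n) : P →ₗ[R] R := LinearMap.proj j ∘ₗ g
  let e (j : Fin n) : P := f (Pi.single j 1)
  have hξ (x : P) : x = ∑ j, ξ j x • e j := by
    conv_lhs => rw [← LinearMap.id_apply (R := R) x, ← hfg, LinearMap.comp_apply,
      pi_eq_sum_univ' (g x), map_sum]
    refine Finset.sum_congr rfl fun j _ => ?_
    rw [map_smul]
    rfl
  have hy (y : P ⊗[R] F) : y = ∑ j, e j ⊗ₜ TensorProduct.lid R F ((ξ j).rTensor F y) := by
    induction y with
    | zero => simp
    | add x y hx hy =>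
      simp only [map_add, tmul_add, Finset.sum_add_distrib]
      rw [← hx, ← hy]
    | tmul x y =>
      conv_lhs => rw [hξ x, sum_tmul]
      simp [smul_tmul]
  constructor
  · refine (injective_iff_map_eq_zero _).2 fun y h => ?_
    rw [hy y]
    refine Finset.sum_eq_zero fun j _ => ?_
    have : TensorProduct.lid R F ((ξ j).rTensor F y) = 0 := by
      refine (injective_iff_map_eq_zero _).1 hC.1 _ ?_
      ext c
      have := congr($h ((ξ j).smulRight c))
      rwa [biduality_apply, rTensor_smulRight] at this
    rw [this, tmul_zero]
  · intro φ
    choose y hy using fun j => hC.2 (φ ∘ₗ LinearMap.smulRightₗ (ξ j))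
    refine ⟨∑ j, e j ⊗ₜ y j, ?_⟩
    ext α : 1
    have hα : α = ∑ j, (ξ j).smulRight (α (e j)) := by
      ext x
      conv_lhs => rw [hξ x, map_sum]
      simp
    conv_rhs => rw [hα]
    rw [map_sum, map_sum, LinearMap.sum_apply]
    refine Finset.sum_congr rfl fun j _ => ?_
    have := congr($(hy j) (α (e j)))
    simpa [biduality_apply] using this

/-- A five lemma chase; surjectivity of `precomp C i` ensures that a map on `Hom(K, C)` is
determined by its pullback to `Hom(P, C)`. -/
lemma biduality_bijective_left [Module.Flat R F] (hi : Function.Injective i)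
    (hp : Function.Surjective p) (hip : Function.Exact i p)
    (hi' : Function.Surjective (precomp C i)) (hP : Function.Bijective (biduality R C F P))
    (hM : Function.Injective (biduality R C F M)) : Function.Bijective (biduality R C F K) := by
  constructor
  · refine (injective_iff_map_eq_zero _).2 fun y hy => ?_
    refine (injective_iff_map_eq_zero _).1 (Module.Flat.rTensor_preserves_injective_linearMap
      i hi) y ?_
    refine (injective_iff_map_eq_zero _).1 hP.1 _ ?_
    ext α : 1
    rw [biduality_rTensor, hy, LinearMap.zero_apply, LinearMap.zero_apply]
  · intro φ
    obtain ⟨z, hz⟩ := hP.2 (φ ∘ₗ precomp C i)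
    have h₀ : p.rTensor F z = 0 := by
      apply hM
      ext α : 1
      rw [biduality_rTensor, hz, LinearMap.comp_apply, lcomp_apply', comp_assoc,
        hip.linearMap_comp_eq_zero, LinearMap.comp_zero, map_zero, map_zero, LinearMap.zero_apply]
    obtain ⟨y, rfl⟩ := (_root_.rTensor_exact F hip hp z).1 h₀
    refine ⟨y, ?_⟩
    ext α : 1
    obtain ⟨β, rfl⟩ := hi' α
    have := congr($hz β)
    rwa [biduality_rTensor] at this

/-- By biduality `φ` is evaluation at an element of `M ⊗ F`, which lifts to `P ⊗ F`. This kills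
`Ext^1(Hom(K, C), C ⊗ F)` for the kernel `K` of `p`. -/
lemma exists_extension_of_biduality (hp : Function.Surjective p)
    (hM : Function.Surjective (biduality R C F M)) (φ : (M →ₗ[R] C) →ₗ[R] C ⊗[R] F) :
    ∃ ψ : (P →ₗ[R] C) →ₗ[R] C ⊗[R] F, ψ ∘ₗ precomp C p = φ := by
  obtain ⟨y, rfl⟩ := hM φ
  obtain ⟨z, rfl⟩ := rTensor_surjective F hp y
  exact ⟨biduality R C F P z, by ext α : 1; rw [biduality_rTensor]; rfl⟩

/-- Lifting through `Hom(P ⊗ Z, N) → Hom(K ⊗ Z, N)` for projective `Z`. -/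
lemma exists_extension_rTensor [Module.Projective R Z]
    (hi : ∀ φ : K →ₗ[R] N, ∃ ψ : P →ₗ[R] N, ψ ∘ₗ i = φ) (φ : K ⊗[R] Z →ₗ[R] N) :
    ∃ ψ : P ⊗[R] Z →ₗ[R] N, ψ ∘ₗ i.rTensor Z = φ := by
  obtain ⟨ψ, hψ⟩ := Module.projective_lifting_property (precomp N i)
    ((TensorProduct.mk R K Z).flip.compr₂ φ) hi
  refine ⟨TensorProduct.lift ψ.flip, ?_⟩
  ext k z
  have := congr($hψ z k)
  simpa using this

end LinearAlgebra

/-! ### Semidualizing modules and their syzygies -/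

section Modules

open TensorProduct

variable {R : Type u} [CommRing R]

lemma isSES_ofHom {X Y Z : Type u} [AddCommGroup X] [Module R X] [AddCommGroup Y] [Module R Y]
    [AddCommGroup Z] [Module R Z] {i : X →ₗ[R] Y} {p : Y →ₗ[R] Z} (hi : Function.Injective i)
    (hp : Function.Surjective p) (hip : Function.Exact i p) :
    IsSES (ModuleCat.ofHom i) (ModuleCat.ofHom p) := by
  have h₁ : Mono (ModuleCat.ofHom i) := (ModuleCat.mono_iff_injective _).2 hi
  have h₂ : Epi (ModuleCat.ofHom p) := (ModuleCat.epi_iff_surjective _).2 hp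
  have w : ModuleCat.ofHom i ≫ ModuleCat.ofHom p = 0 := by
    rw [← ModuleCat.ofHom_comp, hip.linearMap_comp_eq_zero]; rfl
  exact ⟨w, ⟨(ShortComplex.ShortExact.moduleCat_exact_iff_function_exact _).2 hip⟩⟩

namespace IsSES

variable {X Y Z : ModuleCat.{u} R} {i : X ⟶ Y} {p : Y ⟶ Z}

lemma injective (h : IsSES i p) : Function.Injective i.hom := h.2.moduleCat_injective_f

lemma surjective (h : IsSES i p) : Function.Surjective p.hom := h.2.moduleCat_surjective_g

lemma exact (h : IsSES i p) : Function.Exact i.hom p.hom :=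
  (ShortComplex.ShortExact.moduleCat_exact_iff_function_exact _).1 h.2.exact

lemma tensorRight (h : IsSES i p) (M : Type u) [AddCommGroup M] [Module R M] [Module.Flat R M] :
    IsSES (ModuleCat.ofHom (i.hom.rTensor M)) (ModuleCat.ofHom (p.hom.rTensor M)) :=
  isSES_ofHom (Module.Flat.rTensor_preserves_injective_linearMap _ h.injective)
    (LinearMap.rTensor_surjective M h.surjective) (_root_.rTensor_exact M h.exact h.surjective)

end IsSES

lemma ExtVanishing.exists_comp_eq {X Y Z T : ModuleCat.{u} R} {i : X ⟶ Y} {p : Y ⟶ Z}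
    (h : IsSES i p) (hZ : ExtVanishing Z T) (φ : X →ₗ[R] T) :
    ∃ ψ : Y →ₗ[R] T, ψ ∘ₗ i.hom = φ := by
  obtain ⟨ψ, hψ⟩ := hZ.extend h (ModuleCat.ofHom φ)
  exact ⟨ψ.hom, congr($(hψ).hom)⟩

lemma IsSES.hom {X Y Z C : ModuleCat.{u} R} {i : X ⟶ Y} {p : Y ⟶ Z} (h : IsSES i p)
    (hZ : ExtVanishing Z C) :
    IsSES (ModuleCat.ofHom (precomp C p.hom)) (ModuleCat.ofHom (precomp C i.hom)) :=
  isSES_ofHom (LinearMap.lcomp_injective_of_surjective _ h.surjective) (hZ.exists_comp_eq h)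
    (LinearMap.exact_lcomp_of_exact_of_surjective C h.exact h.surjective)

lemma ExtVanishing.tensor {K M : ModuleCat.{u} R} (h : ExtVanishing K M) (Z : Type u)
    [AddCommGroup Z] [Module R Z] [Module.Projective R Z] :
    ExtVanishing (ModuleCat.of R (K ⊗[R] Z)) M := by
  refine ExtVanishing.of_syzygies
    (fun N => ∃ K : ModuleCat.{u} R, ExtVanishing K M ∧ N = ModuleCat.of R (K ⊗[R] Z)) ?_
    ⟨K, h, rfl⟩
  rintro _ ⟨K, h, rfl⟩
  have hs := IsSES.of_epi (Projective.π K)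
  have hP : Module.Projective R (Projective.over K :) :=
    (IsProjective.iff_projective _).2 (inferInstanceAs (Projective (Projective.over K)))
  have : Projective (ModuleCat.of R ((Projective.over K :) ⊗[R] Z)) :=
    (IsProjective.iff_projective _).1 inferInstance
  refine ⟨_, _, _, _, hs.tensorRight Z, ExtVanishing.of_projective _ _,
    ⟨_, (ExtVanishing.of_projective _ _).left hs h, rfl⟩, fun φ => ?_⟩
  obtain ⟨ψ, hψ⟩ := exists_extension_rTensor (h.exists_comp_eq hs) φ.hom
  exact ⟨ModuleCat.ofHom ψ, ModuleCat.hom_ext hψ⟩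

/-- The class of modules which have a resolution by finitely generated projective modules. -/
def HasFiniteResolution : ObjectProperty (ModuleCat.{u} R) := fun M =>
  ∃ S : ObjectProperty (ModuleCat.{u} R), S M ∧ ∀ N, S N → ∃ (K P : ModuleCat.{u} R) (i : K ⟶ P)
    (p : P ⟶ N), IsSES i p ∧ Module.Finite R P ∧ Module.Projective R P ∧ S K

namespace HasFiniteResolution

variable {M : ModuleCat.{u} R}

lemma exists_syzygy (h : HasFiniteResolution M) : ∃ (K P : ModuleCat.{u} R) (i : K ⟶ P)
    (p : P ⟶ M), IsSES i p ∧ Module.Finite R P ∧ Module.Projective R P ∧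
      HasFiniteResolution K := by
  obtain ⟨S, hM, hS⟩ := h
  obtain ⟨K, P, i, p, h₁, h₂, h₃, h₄⟩ := hS M hM
  exact ⟨K, P, i, p, h₁, h₂, h₃, S, h₄, hS⟩

lemma of_projectiveResolution (P : ProjectiveResolution M)
    (hP : ∀ n, Module.Finite R (P.complex.X n)) : HasFiniteResolution M := by
  have hP' (n : ℕ) : Module.Projective R (P.complex.X n) :=
    (IsProjective.iff_projective _).2 (P.projective n)
  refine ⟨fun N => N = M ∨ ∃ k, N = Abelian.image (P.complex.d (k + 1) k), Or.inl rfl, ?_⟩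
  rintro N (rfl | ⟨k, rfl⟩)
  · have hπ : Epi (P.π.f 0) := inferInstance
    exact ⟨_, _, _, _, @IsSES.image_of_epi _ _ _ _ _ _ _ _ hπ _ P.exact₀, hP 0,
      hP' 0, Or.inr ⟨0, rfl⟩⟩
  · exact ⟨_, _, _, _, IsSES.image (P.exact_succ k), hP _, hP' _, Or.inr ⟨k + 1, rfl⟩⟩

lemma homTensor_injective (h : HasFiniteResolution M) (C F : Type u) [AddCommGroup C] [Module R C]
    [AddCommGroup F] [Module R F] [Module.Flat R F] :
    Function.Injective (homTensor R C F M) := by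
  obtain ⟨K, P, i, p, h₁, h₂, h₃, -⟩ := h.exists_syzygy
  exact DingC.homTensor_injective h₁.surjective

lemma homTensor_bijective (h : HasFiniteResolution M) (C F : Type u) [AddCommGroup C] [Module R C]
    [AddCommGroup F] [Module R F] [Module.Flat R F] :
    Function.Bijective (homTensor R C F M) := by
  obtain ⟨K, P, i, p, h₁, h₂, h₃, h₄⟩ := h.exists_syzygy
  exact DingC.homTensor_bijective h₁.surjective h₁.exact (h₄.homTensor_injective C F)

/-- A map `K → C ⊗ F` from the syzygy is an element of `Hom(K, C) ⊗ F`. It lifts to `Hom(P, C) ⊗ F`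
because `Ext^1(M, C) = 0`, so the map extends to `P`. -/
lemma extVanishing_tensor (h : HasFiniteResolution M) {C : ModuleCat.{u} R}
    (hC : ExtVanishing M C) (F : Type u) [AddCommGroup F] [Module R F] [Module.Flat R F] :
    ExtVanishing M (ModuleCat.of R (C ⊗[R] F)) := by
  refine ExtVanishing.of_syzygies (fun M => HasFiniteResolution M ∧ ExtVanishing M C) ?_ ⟨h, hC⟩
  rintro M ⟨h, hC⟩
  obtain ⟨K, P, i, p, h₁, h₂, h₃, h₄⟩ := h.exists_syzygy
  have := (IsProjective.iff_projective P).1 h₃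
  refine ⟨K, P, i, p, h₁, ExtVanishing.of_projective _ _,
    ⟨h₄, (ExtVanishing.of_projective _ _).left h₁ hC⟩, fun φ => ?_⟩
  obtain ⟨y, hy⟩ := (h₄.homTensor_bijective C F).2 φ.hom
  have hi : Function.Surjective (precomp C i.hom) := hC.exists_comp_eq h₁
  obtain ⟨z, rfl⟩ := LinearMap.rTensor_surjective F hi y
  refine ⟨ModuleCat.ofHom (homTensor R C F P z), ModuleCat.hom_ext ?_⟩
  rw [← hy, homTensor_precomp]
  rfl

end HasFiniteResolution

/-- The modules `M` with a resolution by finitely generated projective modules for which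
`Ext^n(M, C) = 0`, `Ext^n(Hom(M, C), C ⊗ F) = 0` and `M ⊗ F ≅ Hom(Hom(M, C), C ⊗ F)` for all
flat modules `F` and all `n ≥ 1`. -/
structure IsBidual (C M : ModuleCat.{u} R) : Prop where
  finite_resolution : HasFiniteResolution M
  ext : ExtVanishing M C
  bijective : ∀ (F : Type u) [AddCommGroup F] [Module R F] [Module.Flat R F],
    Function.Bijective (biduality R C F M)
  ext_dual : ∀ (F : Type u) [AddCommGroup F] [Module R F] [Module.Flat R F],
    ExtVanishing (ModuleCat.of R (M →ₗ[R] C)) (ModuleCat.of R (C ⊗[R] F))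

/-- `Hom(P, C) ≅ C ⊗ P^*` for finitely generated projective `P`. -/
noncomputable def homEquivTensorDual (C P : Type u) [AddCommGroup C] [Module R C]
    [AddCommGroup P] [Module R P] [Module.Finite R P] [Module.Projective R P] :
    (P →ₗ[R] C) ≃ₗ[R] C ⊗[R] Module.Dual R P :=
  (dualTensorHomEquiv R P C).symm ≪≫ₗ TensorProduct.comm R _ _

namespace IsSemidualizing

variable {C : ModuleCat.{u} R} (hC : IsSemidualizing C)

include hC

lemma hasFiniteResolution : HasFiniteResolution C := by
  obtain ⟨P, hP⟩ := hC.finite_resolution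
  exact HasFiniteResolution.of_projectiveResolution P hP

lemma extVanishing : ExtVanishing C C := fun n => hC.ext_eq_zero (n + 1) (by omega)

lemma extVanishing_tensor (F : Type u) [AddCommGroup F] [Module R F] [Module.Flat R F] :
    ExtVanishing C (ModuleCat.of R (C ⊗[R] F)) :=
  hC.hasFiniteResolution.extVanishing_tensor hC.extVanishing F

lemma extVanishing_tensor_tensor (P F : Type u) [AddCommGroup P] [Module R P]
    [Module.Projective R P] [AddCommGroup F] [Module R F] [Module.Flat R F] :
    ExtVanishing (ModuleCat.of R (C ⊗[R] P)) (ModuleCat.of R (C ⊗[R] F)) :=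
  (hC.extVanishing_tensor F).tensor P

lemma isBidual_self : IsBidual C C where
  finite_resolution := hC.hasFiniteResolution
  ext := hC.extVanishing
  bijective F _ _ _ := biduality_self_bijective hC.homothety
  ext_dual F _ _ _ := by
    have : Projective (ModuleCat.of R (C →ₗ[R] C)) := (IsProjective.iff_projective _).1
      (Module.Projective.of_equiv (LinearEquiv.ofBijective _ hC.homothety))
    exact ExtVanishing.of_projective _ _

/-- `Ext^1(M, C) = 0` makes `0 ⟶ Hom(M, C) ⟶ Hom(P, C) ⟶ Hom(K, C) ⟶ 0` exact. Its middle term `C ⊗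
P^*` is orthogonal to `C ⊗ F`, and biduality for `M` extends maps from `Hom(M, C)`, so orthogonality
passes to `Hom(K, C)`. -/
lemma isBidual_left {K P M : ModuleCat.{u} R} {i : K ⟶ P} {p : P ⟶ M} (h : IsSES i p)
    [Module.Finite R P] [Module.Projective R P] (hK : HasFiniteResolution K)
    (hM : IsBidual C M) : IsBidual C K where
  finite_resolution := hK
  ext := by
    have := (IsProjective.iff_projective (R := R) P).1 inferInstance
    exact (ExtVanishing.of_projective _ _).left h hM.ext
  bijective F _ _ _ := biduality_bijective_left h.injective h.surjective h.exact
    (hM.ext.exists_comp_eq h) (biduality_bijective_of_projective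
      (mk_bijective hC.homothety (hC.hasFiniteResolution.homTensor_bijective C F)))
    (hM.bijective F).1
  ext_dual F _ _ _ := by
    refine (hM.ext_dual F).right (h.hom hM.ext)
      ((hC.extVanishing_tensor_tensor (Module.Dual R P) F).of_iso
        (homEquivTensorDual C P).symm.toModuleIso) fun φ => ?_
    obtain ⟨ψ, hψ⟩ := exists_extension_of_biduality h.surjective (hM.bijective F).2 φ.hom
    exact ⟨ModuleCat.ofHom ψ, ModuleCat.hom_ext hψ⟩

end IsSemidualizing

end Modules

/-! ### The resolving class of `D_C`-projective complexes -/

section Tilde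

open TensorProduct

universe t

variable {R : Type u} [CommRing R] {𝒳 : ObjectProperty (ModuleCat.{u} R)}

lemma acyclic_of_iso {X Y : Ch R} (e : X ≅ Y) (h : X.Acyclic) : Y.Acyclic := fun i => by
  have := h i
  rw [HomologicalComplex.exactAt_iff_isZero_homology] at this ⊢
  exact this.of_iso ((HomologicalComplex.homologyFunctor _ _ i).mapIso e).symm

lemma tilde_of_iso [𝒳.IsClosedUnderIsomorphisms] {X Y : Ch R} (e : X ≅ Y) (h : tilde 𝒳 X) :
    tilde 𝒳 Y :=
  ⟨acyclic_of_iso e h.1, fun i =>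
    𝒳.prop_of_iso ((HomologicalComplex.cyclesFunctor _ _ i).mapIso e) (h.2 i)⟩

lemma tilde_disks [𝒳.IsClosedUnderIsomorphisms] {N : ℤ → ModuleCat.{u} R} (h : ∀ n, 𝒳 (N n)) :
    tilde 𝒳 (disks N) :=
  ⟨disks_acyclic N, fun n => 𝒳.prop_of_iso (disksCyclesIso N n).symm (h (n + 1))⟩

lemma tilde_opcycles [𝒳.IsClosedUnderIsomorphisms] {X : Ch R} (h : tilde 𝒳 X) (n : ℤ) :
    𝒳 (X.opcycles n) := by
  obtain ⟨k, rfl⟩ : ∃ k, n = k + 1 := ⟨n - 1, by omega⟩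
  obtain ⟨e⟩ := nonempty_opcycles_iso_cycles h.1 k
  exact 𝒳.prop_of_iso e.symm (h.2 k)

lemma exists_disks_iso [𝒳.IsClosedUnderIsomorphisms]
    (h𝒳 : ∀ M N, 𝒳 M → 𝒳 N → ExtVanishing M N) {X : Ch R} (h : tilde 𝒳 X) :
    ∃ N : ℤ → ModuleCat.{u} R, (∀ n, 𝒳 (N n)) ∧ Nonempty (disks N ≅ X) :=
  ⟨fun n => X.opcycles n, tilde_opcycles h,
    nonempty_disks_iso h.1 fun _ => h𝒳 _ _ (tilde_opcycles h _) (tilde_opcycles h _)⟩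

lemma tilde_biprod [𝒳.IsClosedUnderIsomorphisms]
    (h𝒳 : ∀ M N, 𝒳 M → 𝒳 N → ExtVanishing M N) (h𝒳' : ∀ M N, 𝒳 M → 𝒳 N → 𝒳 (M ⊞ N))
    {X Y : Ch R} (hX : tilde 𝒳 X) (hY : tilde 𝒳 Y) : tilde 𝒳 (X ⊞ Y) := by
  obtain ⟨M, hM, ⟨e⟩⟩ := exists_disks_iso h𝒳 hX
  obtain ⟨N, hN, ⟨e'⟩⟩ := exists_disks_iso h𝒳 hY
  -- `IsSES.isIso_desc` puts the section, here from `disks M`, before the kernel; hence the order `N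
  -- n ⊞ M n`.
  have hs := isSES_disksMap fun n => IsSES.biprod (N n) (M n)
  have := hs.isIso_desc (s := disksMap fun n => biprod.inr) (disks_hom_ext fun n => by
    simp [disksMap])
  let φ : disks M ⊞ disks N ⟶ disks (fun n => N n ⊞ M n) := biprod.desc
    (disksMap fun n => biprod.inr) (disksMap fun n => biprod.inl)
  have : IsIso φ := this
  exact tilde_of_iso ((asIso φ).symm ≪≫ biprod.mapIso e e')
    (tilde_disks fun n => h𝒳' _ _ (hN n) (hM n))

instance : (projectiveModules R).IsClosedUnderIsomorphisms where
  of_iso e h := by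
    have : Module.Projective R _ := h
    exact Module.Projective.of_equiv e.toLinearEquiv

instance (C : ModuleCat.{u} R) : (cProjectiveModules C).IsClosedUnderIsomorphisms where
  of_iso e h := by
    obtain ⟨P, hP, ⟨e'⟩⟩ := h
    exact ⟨P, hP, ⟨e.symm.toLinearEquiv ≪≫ₗ e'⟩⟩

instance (C : ModuleCat.{u} R) : (cFlatModules C).IsClosedUnderIsomorphisms where
  of_iso e h := by
    obtain ⟨P, hP, ⟨e'⟩⟩ := h
    exact ⟨P, hP, ⟨e.symm.toLinearEquiv ≪≫ₗ e'⟩⟩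

lemma exists_disks_iso_of_projective {X : Ch R} (h : tilde (projectiveModules R) X) :
    ∃ N : ℤ → ModuleCat.{u} R, (∀ n, Module.Projective R (N n)) ∧ Nonempty (disks N ≅ X) :=
  exists_disks_iso (fun M N hM _ => by
    have : Projective M := (IsProjective.iff_projective M).1 hM
    exact ExtVanishing.of_projective M N) h

lemma projective_of_tilde {X : Ch R} (h : tilde (projectiveModules R) X) : Projective X := by
  obtain ⟨N, hN, ⟨e⟩⟩ := exists_disks_iso_of_projective h
  exact Projective.of_iso e (projective_disks fun n => (IsProjective.iff_projective (N n)).1 (hN n))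

lemma exists_epi_of_tilde_projective (X : Ch R) :
    ∃ (P : Ch R) (p : P ⟶ X), tilde (projectiveModules R) P ∧ Epi p := by
  let π : disks (fun n => Projective.over (X.X n)) ⟶ X := disksDesc fun n => Projective.π (X.X n)
  have (n : ℤ) : Epi (π.f n) := by
    have h : biprod.inl ≫ π.f n = Projective.π (X.X n) := by
      rw [disksDesc_f, biprod.inl_desc]
    have : Epi (biprod.inl ≫ π.f n) := by rw [h]; infer_instance
    exact epi_of_epi biprod.inl (π.f n)
  exact ⟨_, π, tilde_disks fun n => (IsProjective.iff_projective _).2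
    (inferInstanceAs (Projective (Projective.over (X.X n)))),
    HomologicalComplex.epi_of_epi_f π this⟩

lemma cFlat_of_cProjective {C M : ModuleCat.{u} R} (h : cProjectiveModules C M) :
    cFlatModules C M := by
  obtain ⟨P, hP, e⟩ := h
  exact ⟨P, inferInstance, e⟩

lemma cProjective_biprod {C M N : ModuleCat.{u} R} (hM : cProjectiveModules C M)
    (hN : cProjectiveModules C N) : cProjectiveModules C (M ⊞ N) := by
  obtain ⟨P, hP, ⟨e⟩⟩ := hM
  obtain ⟨Q, hQ, ⟨e'⟩⟩ := hN
  exact ⟨ModuleCat.of R (P × Q), inferInstanceAs (Module.Projective R (P × Q)),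
    ⟨(ModuleCat.biprodIsoProd M N).toLinearEquiv ≪≫ₗ LinearEquiv.prodCongr e e' ≪≫ₗ
      (TensorProduct.prodRight R R C P Q).symm⟩⟩

/-- Each `T_n` is an extension of two opcycle modules, and these are `C`-flat. -/
lemma extVanishing_of_tilde_cFlat {C M : ModuleCat.{u} R}
    (h : ∀ (F : Type u) [AddCommGroup F] [Module R F] [Module.Flat R F],
      ExtVanishing M (ModuleCat.of R (C ⊗[R] F))) {T : Ch R} (hT : tilde (cFlatModules C) T)
    (n : ℤ) : ExtVanishing M (T.X n) := by
  have key (n : ℤ) : ExtVanishing M (T.opcycles n) := by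
    obtain ⟨F, hF, ⟨e⟩⟩ := tilde_opcycles hT n
    exact (h F).of_iso_right e.symm.toModuleIso
  exact (key _).middle_right (isSES_opcycles hT.1 n) (key _)

namespace IsSemidualizing

variable {C : ModuleCat.{u} R} (hC : IsSemidualizing C)

include hC

lemma extVanishing_cProjective_cFlat {M N : ModuleCat.{u} R} (hM : cProjectiveModules C M)
    (hN : cFlatModules C N) : ExtVanishing M N := by
  obtain ⟨P, hP, ⟨e⟩⟩ := hM
  obtain ⟨F, hF, ⟨e'⟩⟩ := hN
  exact ((hC.extVanishing_tensor_tensor P F).of_iso e.symm.toModuleIso).of_iso_right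
    e'.symm.toModuleIso

lemma tilde_cProjective_biprod {X Y : Ch R} (hX : tilde (cProjectiveModules C) X)
    (hY : tilde (cProjectiveModules C) Y) : tilde (cProjectiveModules C) (X ⊞ Y) :=
  tilde_biprod
    (fun _ _ hM hN => hC.extVanishing_cProjective_cFlat hM (cFlat_of_cProjective hN))
    (fun _ _ hM hN => cProjective_biprod hM hN) hX hY

section Ext

variable [HasExt.{t} (Ch R)]

lemma leftPerp_of_tilde_cProjective {X : Ch R} (hX : tilde (cProjectiveModules C) X) :
    leftPerp (tilde (cFlatModules C)) X := fun T hT => by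
  obtain ⟨N, hN, ⟨e⟩⟩ := exists_disks_iso
    (fun _ _ hM hN => hC.extVanishing_cProjective_cFlat hM (cFlat_of_cProjective hN)) hX
  refine (extVanishing_disks fun n => extVanishing_of_tilde_cFlat (fun F _ _ _ =>
    hC.extVanishing_cProjective_cFlat (hN n) ⟨ModuleCat.of R F, ‹_›, ⟨.refl _ _⟩⟩) hT n).of_iso e

lemma coresolved_of_tilde_projective {X : Ch R} (hX : tilde (projectiveModules R) X) :
    Coresolved (tilde (cProjectiveModules C)) (tilde (cFlatModules C)) X := by
  obtain ⟨N, hN, ⟨e⟩⟩ := exists_disks_iso_of_projective hX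
  refine Coresolved.of_iso ?_ e
  -- The witnessing class consists of disks on modules `Hom(M, C) ⊗ Z` with `M` bidual; the start is
  -- `M = C`, `Z = N n`. A syzygy `K` of `M` gives the next cosyzygy `Hom(K, C) ⊗ Z`.
  refine ⟨fun Y => ∃ N : ℤ → ModuleCat.{u} R, Y = disks N ∧ ∀ n, ∃ M Z : ModuleCat.{u} R,
    IsBidual C M ∧ Module.Projective R Z ∧
      Nonempty (N n ≅ ModuleCat.of R ((M →ₗ[R] C) ⊗[R] Z)), ⟨N, rfl, fun n =>
        ⟨C, N n, hC.isBidual_self, hN n, ⟨((TensorProduct.lid R (N n)).symm ≪≫ₗ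
          (LinearEquiv.ofBijective _ hC.homothety).rTensor (N n)).toModuleIso⟩⟩⟩, ?_⟩
  rintro _ ⟨N, rfl, h⟩
  choose M Z hM hZ e using h
  choose K P i p hs hP hP' hK using fun n => (hM n).finite_resolution.exists_syzygy
  have hs' (n : ℤ) := (((hs n).hom (hM n).ext).tensorRight (Z n)).iso_left (e n).some
  refine ⟨fun T hT => extVanishing_disks fun n => extVanishing_of_tilde_cFlat (fun F _ _ _ =>
    (((hM n).ext_dual F).tensor (Z n)).of_iso (e n).some.symm) hT n, _, _, _, _,
    isSES_disksMap hs', tilde_disks fun n => ?_, _, rfl, fun n => ⟨K n, Z n,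
      hC.isBidual_left (hs n) (hK n) (hM n), hZ n, ⟨Iso.refl _⟩⟩⟩
  exact ⟨ModuleCat.of R (Module.Dual R (P n) ⊗[R] Z n),
    inferInstanceAs (Module.Projective R (Module.Dual R (P n) ⊗[R] Z n)),
    ⟨(homEquivTensorDual C (P n)).rTensor (Z n) ≪≫ₗ TensorProduct.assoc R _ _ _⟩⟩

lemma dcProjective_eq : dcProjective C =
    Coresolved (tilde (cProjectiveModules C)) (tilde (cFlatModules C)) := by
  funext X
  refine propext ⟨fun h => ?_, fun h => ?_⟩
  · refine coresolved_of_hasCompleteResolution (P := tilde (projectiveModules R))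
      (fun P hP T _ => ?_)
      (fun _ => hC.leftPerp_of_tilde_cProjective) h
    have := projective_of_tilde hP
    exact ExtVanishing.of_projective P T
  · exact hasCompleteResolution_of_coresolved (P := tilde (projectiveModules R))
      exists_epi_of_tilde_projective
      (fun _ h => ⟨h.1, fun i => cFlat_of_cProjective (h.2 i)⟩)
      (fun _ _ => hC.tilde_cProjective_biprod) (fun _ => hC.coresolved_of_tilde_projective) h

end Ext

lemma isResolving_dcProjective : IsResolving (dcProjective C) := by
  -- Ext groups of complexes are only a tool here, so any model of them will do.
  have := HasExt.standard (Ch R)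
  have hQH (X : Ch R) (h : tilde (cProjectiveModules C) X) : tilde (cFlatModules C) X :=
    ⟨h.1, fun i => cFlat_of_cProjective (h.2 i)⟩
  rw [hC.dcProjective_eq]
  refine ⟨fun h hX hZ => hX.middle hQH (fun _ _ => hC.tilde_cProjective_biprod) h hZ,
    fun h hY hZ => hY.left hQH (fun _ _ => hC.tilde_cProjective_biprod) h hZ, fun X => ?_⟩
  obtain ⟨P, p, hP, hp⟩ := exists_epi_of_tilde_projective X
  exact ⟨P, p, projective_of_tilde hP, hC.coresolved_of_tilde_projective hP, hp⟩

lemma dcPd_le_iff (X : Ch R) (n : ℕ) : dcPd C X ≤ n ↔ HasDim (dcProjective C) n X := by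
  simp only [dcPd, hasResolutionOfLength_iff hC.isResolving_dcProjective]
  refine ⟨fun h => ?_, fun h => iInf₂_le n h⟩
  by_contra hn
  -- If length `n` is impossible, then by monotonicity every possible length is at least `n + 1`,
  -- and so is the infimum.
  have : ((n + 1 : ℕ) : ℕ∞) ≤ n := by
    refine le_trans (le_iInf₂ fun m hm => ?_) h
    rw [Nat.cast_le]
    by_contra! hmn
    exact hn (hC.isResolving_dcProjective.hasDim_mono (by omega) hm)
  rw [Nat.cast_le] at this
  omega

end IsSemidualizing

lemma le_of_forall_natCast {a b : ℕ∞} (h : ∀ n : ℕ, b ≤ n → a ≤ n) : a ≤ b := by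
  rcases eq_or_ne b ⊤ with rfl | h'
  · exact le_top
  · obtain ⟨n, rfl⟩ := ENat.ne_top_iff_exists.1 h'
    exact h n le_rfl

lemma le_max_of_forall_natCast {a b c : ℕ∞} (h : ∀ n : ℕ, b ≤ n → c ≤ n → a ≤ n) :
    a ≤ max b c :=
  le_of_forall_natCast fun n hn => h n ((le_max_left b c).trans hn) ((le_max_right b c).trans hn)

end Tilde

end DingC

/-! ### The corollary -/

theorem corollary3p4 {R : Type u} [CommRing R] (C : ModuleCat.{u} R)
    (hC : DingC.IsSemidualizing C) (X Y Z : DingC.Ch R) (f : X ⟶ Y) (g : Y ⟶ Z)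
    (w : f ≫ g = 0) (hS : (ShortComplex.mk f g w).ShortExact) :
    -- (1), with its consequences
    (∀ n : ℕ, DingC.dcPd C Z ≤ n → (DingC.dcPd C X ≤ n ↔ DingC.dcPd C Y ≤ n)) ∧
    DingC.dcPd C X ≤ max (DingC.dcPd C Y) (DingC.dcPd C Z) ∧
    DingC.dcPd C Y ≤ max (DingC.dcPd C X) (DingC.dcPd C Z) ∧
    -- (2)
    (DingC.dcPd C Z < DingC.dcPd C X ∨ DingC.dcPd C Z < DingC.dcPd C Y →
      DingC.dcPd C X = DingC.dcPd C Y) ∧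
    -- (3)
    (0 < DingC.dcPd C Z → DingC.dcProjective C Y →
      DingC.dcPd C X = DingC.dcPd C Z - 1) ∧
    -- two out of three
    (DingC.dcPd C X < ⊤ → DingC.dcPd C Y < ⊤ → DingC.dcPd C Z < ⊤) ∧
    (DingC.dcPd C X < ⊤ → DingC.dcPd C Z < ⊤ → DingC.dcPd C Y < ⊤) ∧
    (DingC.dcPd C Y < ⊤ → DingC.dcPd C Z < ⊤ → DingC.dcPd C X < ⊤) := by
  have h : DingC.IsSES f g := ⟨w, hS⟩
  have hD := hC.isResolving_dcProjective
  have key := hC.dcPd_le_iff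
  have h₁ (n : ℕ) (hZ : DingC.dcPd C Z ≤ n) : DingC.dcPd C X ≤ n ↔ DingC.dcPd C Y ≤ n := by
    rw [key] at hZ
    rw [key, key]
    exact hD.hasDim_iff h hZ
  have hX : DingC.dcPd C X ≤ max (DingC.dcPd C Y) (DingC.dcPd C Z) :=
    DingC.le_max_of_forall_natCast fun n hY hZ => (h₁ n hZ).2 hY
  have hY : DingC.dcPd C Y ≤ max (DingC.dcPd C X) (DingC.dcPd C Z) :=
    DingC.le_max_of_forall_natCast fun n hX hZ => (h₁ n hZ).1 hX
  refine ⟨h₁, hX, hY, ?_, fun _ hY' => ?_, fun hX' hY' => ?_,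
    fun hX' hZ' => hY.trans_lt (max_lt hX' hZ'), fun hY' hZ' => hX.trans_lt (max_lt hY' hZ')⟩
  · rintro (h' | h')
    · have hXY := (le_max_iff.1 hX).resolve_right h'.not_ge
      exact le_antisymm hXY (hY.trans (max_le le_rfl h'.le))
    · have hYX := (le_max_iff.1 hY).resolve_right h'.not_ge
      exact le_antisymm (hX.trans (max_le le_rfl h'.le)) hYX
  · have hXZ (n : ℕ) : DingC.dcPd C X ≤ n ↔ DingC.dcPd C Z - 1 ≤ n := by
      rw [tsub_le_iff_right, key, ← Nat.cast_one, ← Nat.cast_add, key]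
      exact (hD.hasDim_succ_iff h hY').symm
    exact le_antisymm (DingC.le_of_forall_natCast fun n hn => (hXZ n).2 hn)
      (DingC.le_of_forall_natCast fun n hn => (hXZ n).1 hn)
  · obtain ⟨n, hn⟩ := ENat.ne_top_iff_exists.1 (max_lt hX' hY').ne
    have hX₁ := (key X n).1 ((le_max_left _ _).trans hn.ge)
    have hY₁ := (key Y n).1 ((le_max_right _ _).trans hn.ge)
    exact ((key Z (n + 1)).2 (hD.hasDim_right h hX₁ hY₁)).trans_lt (ENat.natCast_lt_top _)
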